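/- **Setting.** A constraint satisfaction problem (CSP) $S$ specifies, for every positive integer $n$, an alphabet size $w$, a number $\ell$ of variables $x_1,\dots,x_\ell$, an arity $q$, a set $W\subseteq\{0,\dots,w-1\}^{\ell}$ of admissible assignments, and a set $\mathcal R$ of $q$-ary relations on $\{0,\dots,w-1\}$ ($s=|\mathcal R|$). An instance is a sequence $C_1,\dots,C_m$ of constraints (repetitions allowed), each of the form $R(x_{j_1},\dots,x_{j_q})$ with $R\in\mathcal R$ and distinct indices $j_1,\dots,j_q$; its size is $n+m(\log s+q\log \ell)+\ell\log w$, where $\log k$ is read as the number of binary digits of $k$. In the hidden problem with $\{\mathcal V\}$-revealing oracle, an algorithm is given only $n$ and $m$, and may repeatedly propose assignments $a\in W$ (and only such) to an oracle. If $a$ satisfies all constraints, the oracle answers YES; otherwise it reveals the index $j$ of some constraint $C_j$ violated by $a$ together with the tuple $(j_1,\dots,j_q)$ of indices of its variables, but not its relation (which violated constraint is revealed is arbitrary and may change from query to query). The algorithm solves the hidden problem if, for all $n\ge 1$ and $m$, for every instance and every such oracle for it, it outputs an assignment in $W$ that satisfies the instance if there is one, and NO otherwise. The hidden problem is in polynomial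 time if it is solved by one algorithm whose number of steps, a query counting as one step, is bounded by a polynomial in the instance size. **Theorem.** With a $\{\mathcal V\}$-revealing oracle, the hidden versions of the following CSPs are in polynomial time. (a) 2-SAT: $w=2$, $q=2$, $\ell=n$, $W=\{0,1\}^n$, and $\mathcal R$ consists of the ten relations $\mathrm T$, $\mathrm F$, $\alpha$, $\beta$, $\neg\alpha$, $\neg\beta$, $\alpha\vee\beta$, $\alpha\vee\neg\beta$, $\neg\alpha\vee\beta$, $\neg\alpha\vee\neg\beta$ in two Boolean variables $\alpha,\beta$; more generally, the CSP with the same $w,q,\ell,W$ and with an arbitrary set $\mathcal R$ (possibly depending on $n$) of binary relations on $\{0,1\}$. (b) Exact Unique Games over the alphabet $\{0,1\}$: $w=2$, $q=2$, $\ell=n$, $W=\{0,1\}^n$, and $\mathcal R$ consists of the relations $\{(\alpha,\beta):\pi(\alpha)=\beta\}$ for the permutations $\pi$ of $\{0,1\}$. (c) Any monotone graph property decidable in polynomial time. Let $\mathcal P$ be a property of (labelled) graphs on the vertex set $\{1,\dots,n\}$, for every $n$, that is decidable in time polynomial in $n$. If $\mathcal P$ is monotone increasing (preserved under adding edges), the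 CSP has one Boolean variable for each of the $\ell=\binom n2$ pairs of vertices, $w=2$, $q=1$, $W$ is the set of graphs that satisfy $\mathcal P$ and are minimal with respect to inclusion of edge sets, and $\mathcal R=\{\mathsf{Neg}\}$ with $\mathsf{Neg}=\{0\}$ (so a constraint forbids an edge). If $\mathcal P$ is monotone decreasing, then $W$ is the set of inclusion-maximal graphs satisfying $\mathcal P$ and $\mathcal R=\{\mathsf{Id}\}$ with $\mathsf{Id}=\{1\}$. The same holds for properties of directed graphs (loops allowed), with the $\ell=n^2$ ordered pairs of vertices as variables. (d) Equality to a spanning tree: $w=2$, $q=1$, $\ell=\binom n2$ (one variable for each pair of vertices), $W$ is the set of (edge sets of) trees on the vertex set $\{1,\dots,n\}$, and $\mathcal R=\{\mathsf{Id},\mathsf{Neg}\}$. -/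

import Mathlib

namespace HiddenCSP

/-! ### Machine model

Programs of a structured `while` language over binary trees, extended by a query command. Every
executed command (assignment, test, query) costs one step; the expressions occurring in a program
have constant size. With trees kept as shared pointer structures, each step costs a Turing machine
time polynomial in the number of steps made so far, so this unit-cost model defines the usual class
of polynomial-time algorithms. -/

/-- The values that programs work on: binary trees with unlabelled leaves. -/
inductive Dat : Type
  | nil : Dat
  | cons : Dat → Dat → Dat

/-- A natural number in unary notation. -/
def Dat.ofNat : ℕ → Dat
  | 0 => .nil
  | k + 1 => .cons .nil (Dat.ofNat k)

/-- A list of values. -/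
def Dat.ofList : List Dat → Dat
  | [] => .nil
  | d :: l => .cons d (Dat.ofList l)

/-- The list of the values of a function on `Fin k` with values in some `Fin r`. -/
def Dat.ofTuple {k r : ℕ} (a : Fin k → Fin r) : Dat :=
  Dat.ofList (List.ofFn fun i => Dat.ofNat (a i))

theorem Dat.ofNat_injective : Function.Injective Dat.ofNat := by
  intro a
  induction a with
  | zero => intro b h; cases b <;> simp_all [Dat.ofNat]
  | succ a ih =>
    intro b h
    cases b with
    | zero => simp [Dat.ofNat] at h
    | succ b => simp only [Dat.ofNat, Dat.cons.injEq, true_and] at h; rw [ih h]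

theorem Dat.ofList_injective : Function.Injective Dat.ofList := by
  intro a
  induction a with
  | nil => intro b h; cases b <;> simp_all [Dat.ofList]
  | cons x a ih =>
    intro b h
    cases b with
    | nil => simp [Dat.ofList] at h
    | cons y b => simp only [Dat.ofList, Dat.cons.injEq] at h; rw [h.1, ih h.2]

theorem Dat.ofTuple_injective {k r : ℕ} :
    Function.Injective (Dat.ofTuple : (Fin k → Fin r) → Dat) := fun a b h => by
  have h := List.ofFn_injective (Dat.ofList_injective h)
  funext i
  exact Fin.ext (Dat.ofNat_injective (congrFun h i))

def Dat.head : Dat → Dat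
  | .nil => .nil
  | .cons d _ => d

def Dat.tail : Dat → Dat
  | .nil => .nil
  | .cons _ d => d

/-- Expressions; the program variables are numbered. -/
inductive Expr : Type
  | var : ℕ → Expr
  | nil : Expr
  | cons : Expr → Expr → Expr
  | head : Expr → Expr
  | tail : Expr → Expr

/-- The contents of all program variables. -/
abbrev Store : Type := ℕ → Dat

def Expr.eval (σ : Store) : Expr → Dat
  | .var x => σ x
  | .nil => .nil
  | .cons e f => .cons (e.eval σ) (f.eval σ)
  | .head e => (e.eval σ).head
  | .tail e => (e.eval σ).tail

/-- Commands. The tests in `ite` and `loop` succeed if the value of the expression is not `nil`;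
`query x e` sends the value of `e` to the oracle and stores the reply in the variable `x`. -/
inductive Cmd : Type
  | assign : ℕ → Expr → Cmd
  | query : ℕ → Expr → Cmd
  | seq : Cmd → Cmd → Cmd
  | ite : Expr → Cmd → Cmd → Cmd
  | loop : Expr → Cmd → Cmd

/-- `O k d r`: if exactly `k` queries have been made before, then the query `d` is admissible and is
answered by `r`. An execution that makes an inadmissible query is stuck. -/
abbrev Oracle : Type := ℕ → Dat → Dat → Prop

/-- The oracle that admits no query, for ordinary computations. -/
def noOracle : Oracle := fun _ _ _ => False

/-- `Exec O c σ k σ' k' t`: started in the store `σ` after `k` oracle queries, the program `c` halts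
after `t` steps in the store `σ'`, the number of queries made then being `k'`. -/
inductive Exec (O : Oracle) : Cmd → Store → ℕ → Store → ℕ → ℕ → Prop
  | assign (x : ℕ) (e : Expr) (σ : Store) (k : ℕ) :
      Exec O (.assign x e) σ k (Function.update σ x (e.eval σ)) k 1
  | query (x : ℕ) (e : Expr) (σ : Store) (k : ℕ) (r : Dat) (h : O k (e.eval σ) r) :
      Exec O (.query x e) σ k (Function.update σ x r) (k + 1) 1
  | seq {c d : Cmd} {σ σ' σ'' : Store} {k k' k'' t t' : ℕ}
      (h : Exec O c σ k σ' k' t) (h' : Exec O d σ' k' σ'' k'' t') :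
      Exec O (.seq c d) σ k σ'' k'' (t + t')
  | ite_true {e : Expr} {c d : Cmd} {σ σ' : Store} {k k' t : ℕ} (he : e.eval σ ≠ .nil)
      (h : Exec O c σ k σ' k' t) : Exec O (.ite e c d) σ k σ' k' (t + 1)
  | ite_false {e : Expr} {c d : Cmd} {σ σ' : Store} {k k' t : ℕ} (he : e.eval σ = .nil)
      (h : Exec O d σ k σ' k' t) : Exec O (.ite e c d) σ k σ' k' (t + 1)
  | loop_done {e : Expr} {c : Cmd} {σ : Store} {k : ℕ} (he : e.eval σ = .nil) :
      Exec O (.loop e c) σ k σ k 1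
  | loop_step {e : Expr} {c : Cmd} {σ σ' σ'' : Store} {k k' k'' t t' : ℕ} (he : e.eval σ ≠ .nil)
      (h : Exec O c σ k σ' k' t) (h' : Exec O (.loop e c) σ' k' σ'' k'' t') :
      Exec O (.loop e c) σ k σ'' k'' (t + t' + 1)

/-- On input `d` and with the oracle `O`, the program `c` halts with output `r` after `t` steps.
Input and output stand in the variable `0`; the other variables are initially `nil`. -/
def Computes (O : Oracle) (c : Cmd) (d r : Dat) (t : ℕ) : Prop :=
  ∃ (σ : Store) (k : ℕ), Exec O c (Function.update (fun _ => Dat.nil) 0 d) 0 σ k t ∧ σ 0 = r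

/-- Executions are deterministic, if the oracle gives only one answer to each query. -/
theorem Exec.deterministic {O : Oracle} (hO : ∀ k d r r', O k d r → O k d r' → r = r')
    {c : Cmd} {σ σ₁ : Store} {k k₁ t₁ : ℕ} (h : Exec O c σ k σ₁ k₁ t₁) :
    ∀ {σ₂ : Store} {k₂ t₂ : ℕ}, Exec O c σ k σ₂ k₂ t₂ → σ₁ = σ₂ ∧ k₁ = k₂ ∧ t₁ = t₂ := by
  induction h with
  | assign => rintro _ _ _ ⟨⟩; exact ⟨rfl, rfl, rfl⟩
  | query x e σ k r h =>
    intro _ _ _ h2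
    cases h2 with
    | query _ _ _ _ r' h' => rw [hO _ _ _ _ h h']; exact ⟨rfl, rfl, rfl⟩
  | seq _ _ ih1 ih2 =>
    intro _ _ _ h2
    cases h2 with
    | seq a b =>
      obtain ⟨rfl, rfl, rfl⟩ := ih1 a
      obtain ⟨rfl, rfl, rfl⟩ := ih2 b
      exact ⟨rfl, rfl, rfl⟩
  | ite_true he _ ih =>
    intro _ _ _ h2
    cases h2 with
    | ite_true _ a => obtain ⟨rfl, rfl, rfl⟩ := ih a; exact ⟨rfl, rfl, rfl⟩
    | ite_false he' _ => exact absurd he' he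
  | ite_false he _ ih =>
    intro _ _ _ h2
    cases h2 with
    | ite_true he' _ => exact absurd he he'
    | ite_false _ a => obtain ⟨rfl, rfl, rfl⟩ := ih a; exact ⟨rfl, rfl, rfl⟩
  | loop_done he =>
    intro _ _ _ h2
    cases h2 with
    | loop_done => exact ⟨rfl, rfl, rfl⟩
    | loop_step he' _ _ => exact absurd he he'
  | loop_step he _ _ ih1 ih2 =>
    intro _ _ _ h2
    cases h2 with
    | loop_done he' => exact absurd he' he
    | loop_step _ a b =>
      obtain ⟨rfl, rfl, rfl⟩ := ih1 a
      obtain ⟨rfl, rfl, rfl⟩ := ih2 b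
      exact ⟨rfl, rfl, rfl⟩

/-! ### Constraint satisfaction problems -/

/-- A constraint satisfaction problem: for every `n`, an alphabet size, an assignment length, a set
of admissible assignments, an arity, and a set of relations of this arity. -/
structure CSP where
  /-- alphabet size -/
  w : ℕ → ℕ
  /-- assignment length, i.e. number of variables -/
  len : ℕ → ℕ
  /-- arity -/
  q : ℕ → ℕ
  /-- admissible assignments -/
  W : ∀ n, Set (Fin (len n) → Fin (w n))
  /-- type: the set of relations -/
  rels : ∀ n, Set (Set (Fin (q n) → Fin (w n)))

namespace CSP

variable (S : CSP)

abbrev Assignment (n : ℕ) : Type := Fin (S.len n) → Fin (S.w n)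

/-- A relation of the type, applied to a tuple of distinct variables. -/
structure Constraint (n : ℕ) where
  rel : Set (Fin (S.q n) → Fin (S.w n))
  rel_mem : rel ∈ S.rels n
  vars : Fin (S.q n) ↪ Fin (S.len n)

/-- An instance: a sequence of `m` constraints, in which repetitions are allowed. -/
abbrev Instance (n m : ℕ) : Type := Fin m → S.Constraint n

/-- The number of relations. -/
noncomputable def s (n : ℕ) : ℕ := (S.rels n).ncard

/-- The size `n + m (log s + q log ℓ) + ℓ log w` of an instance, where the logarithm of a number
is taken as the number of its binary digits. -/
noncomputable def size (n m : ℕ) : ℕ :=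
  n + m * (Nat.size (S.s n) + S.q n * Nat.size (S.len n)) + S.len n * Nat.size (S.w n)

variable {S}
variable {n m : ℕ}

def Constraint.Sat (c : S.Constraint n) (a : S.Assignment n) : Prop :=
  (fun i => a (c.vars i)) ∈ c.rel

def Satisfies (a : S.Assignment n) (C : S.Instance n m) : Prop := ∀ j, (C j).Sat a

/-- A solution: a satisfying admissible assignment if there is one, and `none` (NO) otherwise. -/
def IsSolution (C : S.Instance n m) : Option (S.Assignment n) → Prop
  | some a => a ∈ S.W n ∧ Satisfies a C
  | none => ∀ a ∈ S.W n, ¬ Satisfies a C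

/-- What the oracle answers to a proposed assignment: `none` is YES, and `some (j, v)` says that the
`j`-th constraint is violated and that `v` is the tuple of its variables. -/
abbrev Answer (S : CSP) (n m : ℕ) : Type := Option (Fin m × (Fin (S.q n) → Fin (S.len n)))

/-- The correct answers of a variable-revealing oracle for `C` to the proposal `a`. -/
def CorrectAnswer (C : S.Instance n m) (a : S.Assignment n) : S.Answer n m → Prop
  | none => Satisfies a C
  | some (j, v) => ¬ (C j).Sat a ∧ v = (C j).vars

/-- `V k a` is the answer to the proposal `a` if it is the query number `k`. The dependence on `k`
lets an oracle disclose different violated constraints when it is asked again. -/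
def IsRevealing (C : S.Instance n m) (V : ℕ → S.Assignment n → S.Answer n m) : Prop :=
  ∀ k, ∀ a ∈ S.W n, CorrectAnswer C a (V k a)

def encodeAnswer : S.Answer n m → Dat
  | none => .nil
  | some (j, v) => .cons (Dat.ofNat j) (Dat.ofTuple v)

def encodeOutput : Option (S.Assignment n) → Dat
  | none => .nil
  | some a => .cons .nil (Dat.ofTuple a)

/-- The oracle as seen by a program: only admissible assignments may be proposed. -/
def oracle (V : ℕ → S.Assignment n → S.Answer n m) : Oracle :=
  fun k d r => ∃ a ∈ S.W n, d = Dat.ofTuple a ∧ r = encodeAnswer (V k a)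

theorem oracle_functional (V : ℕ → S.Assignment n → S.Answer n m) (k : ℕ) (d r r' : Dat)
    (h : oracle V k d r) (h' : oracle V k d r') : r = r' := by
  obtain ⟨a, _, rfl, rfl⟩ := h
  obtain ⟨b, _, hd, rfl⟩ := h'
  rw [Dat.ofTuple_injective hd]

variable (S)

/-- The hidden problem with variable-revealing oracle is solvable in polynomial time: a single
program, given only `n` and `m` and access to an arbitrary revealing oracle of an arbitrary
instance, outputs a solution of this instance in time polynomial in the instance size. -/
def HiddenPolyTime : Prop :=
  ∃ (c : Cmd) (p : Polynomial ℕ), ∀ n m : ℕ, 0 < n → ∀ C : S.Instance n m,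
    ∀ V : ℕ → S.Assignment n → S.Answer n m, IsRevealing C V →
      ∃ (t : ℕ) (out : Option (S.Assignment n)),
        Computes (oracle V) c (.cons (Dat.ofNat n) (Dat.ofNat m)) (encodeOutput out) t ∧
          t ≤ p.eval (S.size n m) ∧ IsSolution C out

end CSP

/-! ### The problems -/

/-- The problem with `n` Boolean variables (`1` is true, `0` is false), all assignments admissible,
and the given sets of binary relations. -/
def binaryBoolean (R : ℕ → Set (Set (Fin 2 → Fin 2))) : CSP where
  w _ := 2
  len n := n
  q _ := 2
  W _ := Set.univ
  rels := R

/-- Satisfiability of conjunctions of disjunctions of at most two literals. -/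
def twoSAT : CSP := binaryBoolean fun _ =>
  {Set.univ, ∅, {b | b 0 = 1}, {b | b 1 = 1}, {b | b 0 = 0}, {b | b 1 = 0},
    {b | b 0 = 1 ∨ b 1 = 1}, {b | b 0 = 1 ∨ b 1 = 0},
    {b | b 0 = 0 ∨ b 1 = 1}, {b | b 0 = 0 ∨ b 1 = 0}}

/-- Exact unique games over an alphabet with `k` letters: label `n` vertices such that for each
edge the label of one end point is sent to that of the other by the permutation of the edge. -/
def uniqueGames (k : ℕ) : CSP where
  w _ := k
  len n := n
  q _ := 2
  W _ := Set.univ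
  rels _ := {R | ∃ π : Equiv.Perm (Fin k), R = {b | π (b 0) = b 1}}

/-- The unary Boolean relation satisfied by `1` only. -/
def idRel : Set (Fin 1 → Fin 2) := {b | b 0 = 1}

/-- The unary Boolean relation satisfied by `0` only. -/
def negRel : Set (Fin 1 → Fin 2) := {b | b 0 = 0}

/-- The graph on `n` vertices given by `n choose 2` bits; the bit of the pair `u < v` has the index
`(v choose 2) + u`. -/
def graphOf {n : ℕ} (a : Fin (n.choose 2) → Fin 2) : SimpleGraph (Fin n) where
  Adj u v := u ≠ v ∧ ∃ e : Fin (n.choose 2),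
    (e : ℕ) = (max (u : ℕ) v).choose 2 + min (u : ℕ) v ∧ a e = 1
  symm := ⟨fun u v ⟨h, e, he, ha⟩ => ⟨h.symm, e, by rw [he, max_comm, min_comm], ha⟩⟩
  loopless := ⟨fun _ h => h.1 rfl⟩

/-- The directed graph on `n` vertices, loops being allowed, given by `n * n` bits. -/
def digraphOf {n : ℕ} (a : Fin (n * n) → Fin 2) : Digraph (Fin n) where
  Adj u v := a (finProdFinEquiv (u, v)) = 1

/-- The property `f` of bit strings (of length `len n` for each `n`) is decided in time polynomial
in `n`. -/
def DecidablePolyTime (len : ℕ → ℕ) (f : ∀ n, (Fin (len n) → Fin 2) → Prop) : Prop :=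
  ∃ (c : Cmd) (p : Polynomial ℕ), ∀ n : ℕ, 0 < n → ∀ a : Fin (len n) → Fin 2,
    ∃ (t : ℕ) (r : Dat),
      Computes noOracle c (.cons (Dat.ofNat n) (Dat.ofTuple a)) r t ∧
        t ≤ p.eval n ∧ (r ≠ .nil ↔ f n a)

/-- For an increasing `f`: find a minimal bit string with the property `f` that avoids the positions
named by the constraints. -/
def increasingCSP (len : ℕ → ℕ) (f : ∀ n, (Fin (len n) → Fin 2) → Prop) : CSP where
  w _ := 2
  len := len
  q _ := 1
  W n := {a | Minimal (f n) a}
  rels _ := {negRel}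

/-- For a decreasing `f`: find a maximal bit string with the property `f` that contains the positions
named by the constraints. -/
def decreasingCSP (len : ℕ → ℕ) (f : ∀ n, (Fin (len n) → Fin 2) → Prop) : CSP where
  w _ := 2
  len := len
  q _ := 1
  W n := {a | Maximal (f n) a}
  rels _ := {idRel}

/-- Equality to a member of a class `K` of graphs: each constraint requires some pair of vertices to
be an edge, or not to be an edge. -/
def equalityCSP (K : ∀ n, Set (SimpleGraph (Fin n))) : CSP where
  w _ := 2
  len n := n.choose 2
  q _ := 1
  W n := {a | graphOf a ∈ K n}
  rels _ := {idRel, negRel}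

/-- Equality to a spanning tree. -/
def equalitySpanningTree : CSP := equalityCSP fun _ => {G | G.IsTree}

end HiddenCSP

open HiddenCSP

/-!
The solver keeps a record of what the answers of the oracle have excluded so far, and proposes an
assignment that is consistent with this record. Each answer excludes something new, while what holds
for the satisfying assignments is never excluded; since this can happen only polynomially often, the
solver stops, and its lack of a consistent proposal proves that there is no solution.

For binary Boolean constraints, the record consists of the excluded patterns (values of a pair of
variables): an answer that names two variables excludes the pattern they had in the proposal. Since
the rejected proposal avoids all earlier patterns, the next one is obtained from it by flipping one
of the two variables together with all the flips that this forces; if neither of the two flips leads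
to an assignment that avoids all patterns, there is none.

For a monotone property, the record consists of the positions that have not been excluded, and the
proposal is a minimal set of such positions with the property, found greedily. For spanning trees,
an answer tells whether the edge is required or forbidden, and the proposal is found by removing
edges from the graph of the edges that are not forbidden, as long as it remains connected, the
required edges last.

That all this takes polynomial time on the machine follows from closure properties of the class of
functions that are computable in polynomial time.
-/

namespace HiddenCSP

/-! ### Encodings -/

/-- The height of a value as a binary tree. Unlike the number of nodes, it only grows by one when a
value is paired with itself. -/
def Dat.height : Dat → ℕ
  | .nil => 0
  | .cons d e => max d.height e.height + 1

/-- Types whose elements are represented by values of the machine model. -/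
class ToDat (α : Type) where
  toDat : α → Dat

open HiddenCSP.ToDat (toDat)

instance : ToDat Bool := ⟨fun b => bif b then .cons .nil .nil else .nil⟩

instance : ToDat ℕ := ⟨Dat.ofNat⟩

instance {α β : Type} [ToDat α] [ToDat β] : ToDat (α × β) :=
  ⟨fun x => .cons (toDat x.1) (toDat x.2)⟩

instance {α : Type} [ToDat α] : ToDat (List α) := ⟨fun l => Dat.ofList (l.map toDat)⟩

instance {α : Type} [ToDat α] : ToDat (Option α) :=
  ⟨fun o => o.elim .nil fun a => .cons .nil (toDat a)⟩

instance {α : Type} [ToDat α] {p : α → Prop} : ToDat (Subtype p) := ⟨fun a => toDat a.1⟩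

section Encodings

variable {α β : Type} [ToDat α] [ToDat β]

@[simp] theorem toDat_false : toDat false = Dat.nil := rfl
@[simp] theorem toDat_true : toDat true = Dat.cons .nil .nil := rfl
@[simp] theorem toDat_zero : toDat 0 = Dat.nil := rfl
@[simp] theorem toDat_succ (n : ℕ) : toDat (n + 1) = Dat.cons .nil (toDat n) := rfl
@[simp] theorem toDat_pair (a : α) (b : β) : toDat (a, b) = Dat.cons (toDat a) (toDat b) := rfl
@[simp] theorem toDat_nil : toDat ([] : List α) = Dat.nil := rfl
@[simp] theorem toDat_cons (a : α) (l : List α) :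
    toDat (a :: l) = Dat.cons (toDat a) (toDat l) := rfl
@[simp] theorem toDat_none : toDat (none : Option α) = Dat.nil := rfl
@[simp] theorem toDat_some (a : α) : toDat (some a) = Dat.cons .nil (toDat a) := rfl

theorem toDat_replicate_false (n : ℕ) : toDat (List.replicate n false) = toDat n := by
  induction n with
  | zero => rfl
  | succ n ih => simp [List.replicate_succ, ih]

theorem toDat_ofFn_val {k r : ℕ} (v : Fin k → Fin r) :
    toDat (List.ofFn fun i => (v i : ℕ)) = Dat.ofTuple v := by
  change Dat.ofList (List.map Dat.ofNat _) = _
  rw [List.map_ofFn]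
  rfl

/-- The height of the value that represents `a`, the size of `a` in all polynomial bounds. -/
def height (a : α) : ℕ := (toDat a).height

@[simp] theorem height_pair (a : α) (b : β) : height (a, b) = max (height a) (height b) + 1 := rfl
@[simp] theorem height_nil : height ([] : List α) = 0 := rfl
@[simp] theorem height_cons (a : α) (l : List α) :
    height (a :: l) = max (height a) (height l) + 1 := rfl
@[simp] theorem height_none : height (none : Option α) = 0 := rfl
@[simp] theorem height_some (a : α) : height (some a) = height a + 1 := by
  simp [height, Dat.height]
@[simp] theorem height_subtype {p : α → Prop} (a : Subtype p) : height a = height a.1 := rfl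

@[simp] theorem height_nat (n : ℕ) : height n = n := by
  induction n with
  | zero => rfl
  | succ n ih => simpa [height, Dat.height] using ih

theorem height_bool_le (b : Bool) : height b ≤ 1 := by cases b <;> decide

theorem length_le_height (l : List α) : l.length ≤ height l := by
  induction l with
  | nil => simp
  | cons a l ih => rw [height_cons, List.length_cons]; omega

theorem height_le_of_mem {a : α} {l : List α} (h : a ∈ l) : height a ≤ height l := by
  induction h with
  | head l => rw [height_cons]; omega
  | tail b _ ih => rw [height_cons]; omega

theorem height_list_le {l : List α} {B : ℕ} (h : ∀ a ∈ l, height a ≤ B) :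
    height l ≤ B + l.length := by
  induction l with
  | nil => simp
  | cons a l ih =>
    rw [List.forall_mem_cons] at h
    have := ih h.2
    rw [height_cons, List.length_cons]
    omega

theorem height_listBool_le (l : List Bool) : height l ≤ 1 + l.length :=
  height_list_le fun b _ => height_bool_le b

end Encodings

/-! ### Polynomial bounds -/

theorem eval_mono (p : Polynomial ℕ) : Monotone fun n => p.eval n := fun a b h => by
  simp only [Polynomial.eval_eq_sum_range]
  gcongr

/-- The values of `g` are bounded by a polynomial in the height of the argument. -/
@[fun_prop]
def PolyBounded {α : Type} [ToDat α] (g : α → ℕ) : Prop :=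
  ∃ p : Polynomial ℕ, ∀ a, g a ≤ p.eval (height a)

namespace PolyBounded

variable {α β : Type} [ToDat α] [ToDat β] {f g : α → ℕ}

theorem mono (hg : PolyBounded g) (h : ∀ a, f a ≤ g a) : PolyBounded f :=
  hg.imp fun _ hp a => (h a).trans (hp a)

theorem height_self : PolyBounded fun a : α => height a := ⟨.X, fun _ => by simp⟩

protected theorem id : PolyBounded fun n : ℕ => n := height_self.mono fun n => (height_nat n).ge

@[fun_prop]
protected theorem const (n : ℕ) : PolyBounded fun _ : α => n := ⟨.C n, fun _ => by simp⟩

@[fun_prop]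
protected theorem add (hf : PolyBounded f) (hg : PolyBounded g) :
    PolyBounded fun a => f a + g a := by
  obtain ⟨⟨p, hp⟩, q, hq⟩ := And.intro hf hg
  exact ⟨p + q, fun a => by simpa using Nat.add_le_add (hp a) (hq a)⟩

@[fun_prop]
protected theorem mul (hf : PolyBounded f) (hg : PolyBounded g) :
    PolyBounded fun a => f a * g a := by
  obtain ⟨⟨p, hp⟩, q, hq⟩ := And.intro hf hg
  exact ⟨p * q, fun a => by simpa using Nat.mul_le_mul (hp a) (hq a)⟩

@[fun_prop]
protected theorem max (hf : PolyBounded f) (hg : PolyBounded g) :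
    PolyBounded fun a => max (f a) (g a) :=
  (hf.add hg).mono fun _ => max_le (Nat.le_add_right _ _) (Nat.le_add_left _ _)

@[fun_prop]
theorem eval (p : Polynomial ℕ) (hf : PolyBounded f) : PolyBounded fun a => p.eval (f a) := by
  obtain ⟨q, hq⟩ := hf
  exact ⟨p.comp q, fun a => by simpa using eval_mono p (hq a)⟩

theorem comp_of_height {g : β → ℕ} {f : α → β} (hg : PolyBounded g)
    (hf : PolyBounded fun a => height (f a)) : PolyBounded fun a => g (f a) := by
  obtain ⟨p, hp⟩ := hg
  exact (hf.eval p).mono fun a => hp (f a)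

end PolyBounded

/-! ### Running times of commands -/

/-- With the oracle `O`, no matter how many queries have been made before, `c` started in `σ` halts
after at most `T` steps in a store satisfying `P`. -/
def Run (O : Oracle) (c : Cmd) (σ : Store) (T : ℕ) (P : Store → Prop) : Prop :=
  ∀ k, ∃ σ' k' t, Exec O c σ k σ' k' t ∧ t ≤ T ∧ P σ'

namespace Run

variable {O : Oracle} {c d : Cmd} {σ : Store} {T T' x : ℕ} {P Q : Store → Prop} {e : Expr}

theorem mono (h : Run O c σ T P) (hT : T ≤ T') (hP : ∀ σ', P σ' → Q σ') : Run O c σ T' Q :=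
  fun k =>
    let ⟨σ', k', t, hc, ht, hσ'⟩ := h k
    ⟨σ', k', t, hc, ht.trans hT, hP _ hσ'⟩

theorem assign (h : P (Function.update σ x (e.eval σ))) : Run O (.assign x e) σ 1 P :=
  fun _ => ⟨_, _, _, .assign .., le_rfl, h⟩

theorem query (h : ∀ k, ∃ r, O k (e.eval σ) r ∧ P (Function.update σ x r)) :
    Run O (.query x e) σ 1 P := fun k =>
  let ⟨_, hr, hP⟩ := h k
  ⟨_, _, _, .query _ _ _ _ _ hr, le_rfl, hP⟩

theorem seq (h : Run O c σ T P) (h' : ∀ σ', P σ' → Run O d σ' T' Q) :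
    Run O (.seq c d) σ (T + T') Q := fun k =>
  let ⟨_, _, _, hc, ht, hP⟩ := h k
  let ⟨_, _, _, hd, ht', hQ⟩ := h' _ hP _
  ⟨_, _, _, hc.seq hd, by omega, hQ⟩

theorem assign_seq (h : Run O d (Function.update σ x (e.eval σ)) T P) :
    Run O (.seq (.assign x e) d) σ (1 + T) P :=
  (assign (P := (· = _)) rfl).seq fun _ hσ' => hσ' ▸ h

theorem ite_true (he : e.eval σ ≠ .nil) (h : Run O c σ T P) :
    Run O (.ite e c d) σ (T + 1) P := fun k =>
  let ⟨_, _, _, hc, ht, hP⟩ := h k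
  ⟨_, _, _, .ite_true he hc, by omega, hP⟩

theorem ite_false (he : e.eval σ = .nil) (h : Run O d σ T P) :
    Run O (.ite e c d) σ (T + 1) P := fun k =>
  let ⟨_, _, _, hd, ht, hP⟩ := h k
  ⟨_, _, _, .ite_false he hd, by omega, hP⟩

theorem loop_done (he : e.eval σ = .nil) (h : P σ) : Run O (.loop e c) σ 1 P :=
  fun _ => ⟨_, _, _, .loop_done he, le_rfl, h⟩

theorem loop_step (he : e.eval σ ≠ .nil) (h : Run O c σ T P)
    (h' : ∀ σ', P σ' → Run O (.loop e c) σ' T' Q) : Run O (.loop e c) σ (T + T' + 1) Q := fun k =>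
  let ⟨_, _, _, hc, ht, hP⟩ := h k
  let ⟨_, _, _, hl, ht', hQ⟩ := h' _ hP _
  ⟨_, _, _, .loop_step he hc hl, by omega, hQ⟩

end Run

/-- The store `σ'` results from `σ` by a subroutine that uses the variables `0, …, N` and leaves its
result `d` in the variable `0`. -/
def Returns (N : ℕ) (d : Dat) (σ σ' : Store) : Prop := σ' 0 = d ∧ ∀ x, N < x → σ' x = σ x

/-- The subroutine that replaces a value by a Boolean, namely whether it differs from `nil`. -/
def Cmd.toBool : Cmd := .ite (.var 0) (.assign 0 (.cons .nil .nil)) (.assign 0 .nil)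

theorem Cmd.run_toBool {O : Oracle} {σ : Store} {b : Bool} (h : σ 0 ≠ .nil ↔ b = true) :
    Run O Cmd.toBool σ 2 (Returns 0 (toDat b) σ) := by
  cases b with
  | false =>
    refine .ite_false (by simpa [Expr.eval] using h) (.assign ⟨by simp [Expr.eval], fun x hx => ?_⟩)
    exact Function.update_of_ne hx.ne' _ _
  | true =>
    refine .ite_true (by simpa [Expr.eval] using h) (.assign ⟨by simp [Expr.eval], fun x hx => ?_⟩)
    exact Function.update_of_ne hx.ne' _ _

/-! ### Functions computable in polynomial time -/

/-- The program `c` computes `f` as a subroutine with scratch variables up to `N`, in time `T`. -/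
def Implements {α β : Type} [ToDat α] [ToDat β] (c : Cmd) (N : ℕ) (f : α → β) (T : α → ℕ) : Prop :=
  ∀ (O : Oracle) (a : α) (σ : Store), σ 0 = toDat a →
    Run O c σ (T a) (Returns N (toDat (f a)) σ)

theorem Implements.mono {α β : Type} [ToDat α] [ToDat β] {c : Cmd} {N N' : ℕ} {f : α → β}
    {T : α → ℕ} (h : Implements c N f T) (hN : N ≤ N') : Implements c N' f T := fun O a σ hσ =>
  (h O a σ hσ).mono le_rfl fun _ hσ' => ⟨hσ'.1, fun x hx => hσ'.2 x (by omega)⟩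

/-- A function computable in time polynomial in the height of the argument, and with values of
polynomial height. In the second part the time bound is of no help, since `Implements` allows for
scratch variables that initially contain arbitrary values. -/
@[fun_prop]
def PolyTime {α β : Type} [ToDat α] [ToDat β] (f : α → β) : Prop :=
  (∃ c N T, Implements c N f T ∧ PolyBounded T) ∧ PolyBounded fun a => height (f a)

/-- An expression with a given value. -/
def Dat.quote : Dat → Expr
  | .nil => .nil
  | .cons d e => .cons d.quote e.quote

theorem Dat.eval_quote (d : Dat) (σ : Store) : d.quote.eval σ = d := by
  induction d with
  | nil => rfl
  | cons d e hd he => rw [quote, Expr.eval, hd, he]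

/-- One round of `Cmd.fold`: in the triple of a parameter, an accumulator and a list that stands in
the variable `N + 1`, the head of the list is moved into the accumulator by means of `c`. -/
def Cmd.foldStep (c : Cmd) (N : ℕ) : Cmd :=
  .seq (.assign 0 (.cons (.head (.var (N + 1))) (.cons (.head (.tail (.var (N + 1))))
    (.head (.tail (.tail (.var (N + 1)))))))) <|
  .seq c <|
  .assign (N + 1) (.cons (.head (.var (N + 1)))
    (.cons (.var 0) (.tail (.tail (.tail (.var (N + 1)))))))

/-- The rounds `Cmd.foldStep c N` until the list is exhausted. -/
def Cmd.fold (c : Cmd) (N : ℕ) : Cmd :=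
  .loop (.tail (.tail (.var (N + 1)))) (c.foldStep N)

section Fold

variable {α β γ : Type} [ToDat α] [ToDat β] [ToDat γ] {f : α → β → γ → β} {c : Cmd} {N : ℕ}
  {T : α × β × γ → ℕ} {O : Oracle}

theorem Cmd.run_foldStep (hc : Implements c N (fun y : α × β × γ => f y.1 y.2.1 y.2.2) T)
    {a : α} {b : β} {x : γ} {l : List γ} {σ : Store} (hσ : σ (N + 1) = toDat (a, b, x :: l)) :
    Run O (c.foldStep N) σ (T (a, b, x) + 2) fun σ' =>
      σ' (N + 1) = toDat (a, f a b x, l) ∧ ∀ y, N + 1 < y → σ' y = σ y := by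
  have start : Run O (c.foldStep N) σ (1 + (T (a, b, x) + 1)) _ :=
    .assign_seq <| (hc O (a, b, x) _ (by simp [Expr.eval, hσ, Dat.head, Dat.tail])).seq
      fun σ₁ ⟨h0, h⟩ => .assign (P := fun σ' =>
        σ' (N + 1) = toDat (a, f a b x, l) ∧ ∀ y, N + 1 < y → σ' y = σ y)
        ⟨by simp [Expr.eval, h0, h (N + 1), hσ, Dat.head, Dat.tail], fun y hy => by
          rw [Function.update_of_ne (by omega), h y (by omega),
            Function.update_of_ne (by omega)]⟩
  exact start.mono (by omega) fun _ => id

theorem Cmd.run_fold (hc : Implements c N (fun y : α × β × γ => f y.1 y.2.1 y.2.2) T)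
    {a : α} {K : ℕ} (l : List γ) : ∀ {b : β} {σ : Store}, σ (N + 1) = toDat (a, b, l) →
    (∀ l' x, l' ++ [x] <+: l → T (a, l'.foldl (f a) b, x) ≤ K) →
    Run O (c.fold N) σ (l.length * (K + 3) + 1) fun σ' =>
      σ' (N + 1) = toDat (a, l.foldl (f a) b, ([] : List γ)) ∧
        ∀ y, N + 1 < y → σ' y = σ y := by
  induction l with
  | nil =>
    intro b σ hσ _
    exact (Run.loop_done (by simp [Expr.eval, hσ, Dat.tail]) ⟨hσ, fun _ _ => rfl⟩).mono
      (by omega) fun _ => id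
  | cons x l ih =>
    intro b σ hσ hK
    refine (Run.loop_step (by simp [Expr.eval, hσ, Dat.tail]) (run_foldStep hc hσ)
      fun σ₁ ⟨h₁, h₁'⟩ => (ih h₁ fun l' y hl' => ?_).mono le_rfl fun σ₂ ⟨h₂, h₂'⟩ =>
        ⟨h₂, fun y hy => (h₂' y hy).trans (h₁' y hy)⟩).mono ?_ fun _ => id
    · exact hK (x :: l') y ((List.prefix_cons_inj x).mpr hl')
    · have := hK [] x (by simp)
      simp only [List.foldl_nil] at this
      rw [List.length_cons, add_one_mul]
      omega

end Fold

namespace PolyTime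

variable {α β γ α' β' : Type} [ToDat α] [ToDat β] [ToDat γ] [ToDat α'] [ToDat β']

@[fun_prop]
theorem polyBounded_height {f : α → β} (hf : PolyTime f) : PolyBounded fun a => height (f a) :=
  hf.2

theorem polyBounded {f : α → ℕ} (hf : PolyTime f) : PolyBounded f := by
  simpa only [height_nat] using hf.polyBounded_height

theorem of_expr {f : α → β} (e : Expr)
    (he : ∀ a σ, σ 0 = toDat a → e.eval σ = toDat (f a))
    (hf : PolyBounded fun a => height (f a)) : PolyTime f :=
  ⟨⟨.assign 0 e, 0, fun _ => 1, fun _ a σ hσ => .assign ⟨by simp [he a σ hσ], fun x hx =>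
    Function.update_of_ne hx.ne' _ _⟩, .const 1⟩, hf⟩

theorem of_toDat_eq {f : α → β} {f' : α' → β'} (hf : PolyTime f) (i : α' → α)
    (hi : ∀ a, toDat (i a) = toDat a) (h : ∀ a, toDat (f (i a)) = toDat (f' a)) :
    PolyTime f' := by
  obtain ⟨⟨c, N, T, hc, p, hp⟩, q, hq⟩ := hf
  have height_i (a : α') : height (i a) = height a := congrArg Dat.height (hi a)
  refine ⟨⟨c, N, fun a => T (i a), fun O a σ hσ => ?_, p, fun a => ?_⟩, q, fun a => ?_⟩
  · rw [← h]
    exact hc O (i a) σ (hσ.trans (hi a).symm)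
  · exact height_i a ▸ hp (i a)
  · rw [← height_i a]
    exact (congrArg Dat.height (h a)).symm.trans_le (hq (i a))

theorem of_toDat_apply_eq {f : α → β} {f' : α → β'} (hf : PolyTime f)
    (h : ∀ a, toDat (f a) = toDat (f' a)) : PolyTime f' :=
  hf.of_toDat_eq (fun a => a) (fun _ => rfl) h

@[fun_prop]
protected theorem id : PolyTime fun a : α => a :=
  of_expr (.var 0) (fun _ _ h => h) .height_self

@[fun_prop]
protected theorem const (b : β) : PolyTime fun _ : α => b :=
  of_expr (toDat b).quote (fun _ σ _ => Dat.eval_quote _ σ) (.const _)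

@[fun_prop]
protected theorem comp {g : β → γ} {f : α → β} (hg : PolyTime g) (hf : PolyTime f) :
    PolyTime fun a => g (f a) := by
  obtain ⟨⟨⟨c, N, T, hc, hT⟩, hf'⟩, ⟨d, N', T', hd, hT'⟩, hg'⟩ := And.intro hf hg
  have hc := hc.mono (le_max_left N N')
  have hd := hd.mono (le_max_right N N')
  refine ⟨⟨.seq c d, max N N', fun a => T a + T' (f a), fun O a σ hσ => ?_,
    hT.add (hT'.comp_of_height hf')⟩, hg'.comp_of_height hf'⟩
  exact (hc O a σ hσ).seq fun σ₁ ⟨h0, h₁⟩ => (hd O (f a) σ₁ h0).mono le_rfl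
    fun σ₂ ⟨h0, h₂⟩ => ⟨h0, fun x hx => (h₂ x hx).trans (h₁ x hx)⟩

@[fun_prop]
theorem fst {f : α → β × γ} (hf : PolyTime f) : PolyTime fun a => (f a).1 :=
  (of_expr (f := fun y : β × γ => y.1) (.head (.var 0))
    (fun ⟨_, _⟩ _ h => by simp [Expr.eval, h, Dat.head])
    (PolyBounded.height_self.mono fun ⟨_, _⟩ => by simp only [height_pair]; omega)).comp hf

@[fun_prop]
theorem snd {f : α → β × γ} (hf : PolyTime f) : PolyTime fun a => (f a).2 :=
  (of_expr (f := fun y : β × γ => y.2) (.tail (.var 0))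
    (fun ⟨_, _⟩ _ h => by simp [Expr.eval, h, Dat.tail])
    (PolyBounded.height_self.mono fun ⟨_, _⟩ => by simp only [height_pair]; omega)).comp hf

@[fun_prop]
theorem prodMk {f : α → β} {g : α → γ} (hf : PolyTime f) (hg : PolyTime g) :
    PolyTime fun a => (f a, g a) := by
  obtain ⟨⟨⟨c, N, T, hc, hT⟩, hf'⟩, ⟨d, N', T', hd, hT'⟩, hg'⟩ := And.intro hf hg
  set M := max N N'
  have hc := hc.mono (by omega : N ≤ M)
  have hd := hd.mono (by omega : N' ≤ M)
  refine ⟨⟨.seq (.assign (M + 1) (.var 0)) <| .seq c <| .seq (.assign (M + 2) (.var 0)) <|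
    .seq (.assign 0 (.var (M + 1))) <| .seq d <| .assign 0 (.cons (.var (M + 2)) (.var 0)), M + 2,
    fun a => 1 + (T a + (1 + (1 + (T' a + 1)))), fun O a σ hσ => ?_, by fun_prop⟩,
    by simpa only [height_pair] using (hf'.max hg').add (.const 1)⟩
  refine .assign_seq <| (hc O a _ (by simp [Expr.eval, hσ])).seq fun σ₁ ⟨h₁0, h₁⟩ =>
    .assign_seq <| .assign_seq <| (hd O a _ (by simp [Expr.eval, h₁, hσ])).seq
    fun σ₂ ⟨h₂0, h₂⟩ => .assign ⟨?_, fun x hx => ?_⟩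
  · simp [Expr.eval, h₂0, h₂ (M + 2), h₁0]
  · rw [Function.update_of_ne (by omega), h₂ x (by omega), Function.update_of_ne (by omega),
      Function.update_of_ne (by omega), h₁ x (by omega), Function.update_of_ne (by omega)]

theorem of_toDat_eq_nil {f : α → β} {t : α → Bool} (hf : PolyTime f)
    (h : ∀ a, toDat (f a) = .nil ↔ t a = false) : PolyTime t := by
  obtain ⟨⟨c, N, T, hc, hT⟩, -⟩ := hf
  refine ⟨⟨.seq c .toBool, N, fun a => T a + 2, fun O a σ hσ => ?_, hT.add (.const 2)⟩,
    (PolyBounded.const 1).mono fun a => height_bool_le _⟩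
  refine (hc O a σ hσ).seq fun σ₁ ⟨h0, h₁⟩ =>
    (Cmd.run_toBool (b := t a) (by simp [h0, h a])).mono le_rfl fun σ₂ ⟨h0, h₂⟩ =>
      ⟨h0, fun x hx => (h₂ x (by omega)).trans (h₁ x hx)⟩

@[fun_prop]
protected theorem ite {p : α → Prop} [DecidablePred p] {f g : α → β}
    (hp : PolyTime fun a => decide (p a)) (hf : PolyTime f) (hg : PolyTime g) :
    PolyTime fun a => if p a then f a else g a := by
  obtain ⟨⟨b, N₀, T₀, hb, hT₀⟩, -⟩ := hp
  obtain ⟨⟨⟨c, N, T, hc, hT⟩, hf'⟩, ⟨d, N', T', hd, hT'⟩, hg'⟩ := And.intro hf hg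
  set M := max N₀ (max N N')
  have hb := hb.mono (by omega : N₀ ≤ M)
  have hc := hc.mono (by omega : N ≤ M)
  have hd := hd.mono (by omega : N' ≤ M)
  refine ⟨⟨.seq (.assign (M + 1) (.var 0)) <| .seq b <| .ite (.var 0)
      (.seq (.assign 0 (.var (M + 1))) c) (.seq (.assign 0 (.var (M + 1))) d), M + 1,
    fun a => 1 + (T₀ a + (1 + max (T a) (T' a) + 1)), fun O a σ hσ => ?_, by fun_prop⟩,
    (hf'.max hg').mono fun a => by dsimp only; split_ifs <;> omega⟩
  refine .assign_seq <| (hb O a _ (by simp [Expr.eval, hσ])).seq fun σ₁ ⟨h₁0, h₁⟩ => ?_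
  have frame {d₀ : Dat} {σ₂ : Store} (h₂ : Returns M d₀ (Function.update σ₁ 0 (σ₁ (M + 1))) σ₂) :
      Returns (M + 1) d₀ σ σ₂ := ⟨h₂.1, fun x hx => by
    rw [h₂.2 x (by omega), Function.update_of_ne (by omega), h₁ x (by omega),
      Function.update_of_ne (by omega)]⟩
  by_cases hpa : p a
  · refine .ite_true (by simp [Expr.eval, h₁0, hpa]) <| .assign_seq <|
      (hc O a _ (by simp [Expr.eval, h₁, hσ])).mono (le_max_left _ _) fun σ₂ h₂ => ?_
    simpa only [if_pos hpa] using frame h₂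
  · refine .ite_false (by simp [Expr.eval, h₁0, hpa]) <| .assign_seq <|
      (hd O a _ (by simp [Expr.eval, h₁, hσ])).mono (le_max_right _ _) fun σ₂ h₂ => ?_
    simpa only [if_neg hpa] using frame h₂

theorem foldl {f : α → β → γ → β} {b : α → β} {l : α → List γ} {B : α → ℕ}
    (hf : PolyTime fun y : α × β × γ => f y.1 y.2.1 y.2.2) (hb : PolyTime b) (hl : PolyTime l)
    (hB : PolyBounded B) (hfB : ∀ a l', l' <+: l a → height (l'.foldl (f a) (b a)) ≤ B a) :
    PolyTime fun a => (l a).foldl (f a) (b a) := by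
  obtain ⟨⟨c, N, T, hc, p, hp⟩, -⟩ := hf
  obtain ⟨⟨d, N', T', hd, hT'⟩, -⟩ := PolyTime.id.prodMk (hb.prodMk hl)
  set M := max N N'
  have hc := hc.mono (by omega : N ≤ M)
  have hd := hd.mono (by omega : N' ≤ M)
  let K (a : α) : ℕ := p.eval (height a + B a + height (l a) + 2)
  refine ⟨⟨.seq d <| .seq (.assign (M + 1) (.var 0)) <| .seq (c.fold M) <|
      .assign 0 (.head (.tail (.var (M + 1)))), M + 1,
    fun a => T' a + (1 + (height (l a) * (K a + 3) + 1 + 1)), fun O a σ hσ => ?_,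
    by have := PolyBounded.height_self (α := α); fun_prop⟩,
    hB.mono fun a => hfB a (l a) List.prefix_rfl⟩
  have hK (l' : List γ) (x : γ) (hx : l' ++ [x] <+: l a) :
      T (a, l'.foldl (f a) (b a), x) ≤ K a := by
    have h₁ := hfB a l' ((List.prefix_append l' [x]).trans hx)
    have h₂ := height_le_of_mem (hx.subset (by simp : x ∈ l' ++ [x]))
    exact (hp _).trans (eval_mono p (by simp only [height_pair]; omega))
  refine (hd O a σ hσ).seq fun σ₁ ⟨h₁0, h₁⟩ => .assign_seq <|
    ((Cmd.run_fold hc (l a) (by simp [Expr.eval, h₁0]) hK).mono ?_ fun _ => id).seq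
      fun σ₂ ⟨h₂0, h₂⟩ => .assign ⟨?_, fun x hx => ?_⟩
  · gcongr
    exact length_le_height _
  · simp [Expr.eval, h₂0, Dat.head, Dat.tail]
  · rw [Function.update_of_ne (by omega), h₂ x hx, Function.update_of_ne (by omega),
      h₁ x (by omega)]

theorem foldl_of_growth {f : α → β → γ → β} {b : α → β} {l : α → List γ} {G : α → ℕ}
    (hf : PolyTime fun y : α × β × γ => f y.1 y.2.1 y.2.2) (hb : PolyTime b) (hl : PolyTime l)
    (hG : PolyBounded G) (hfG : ∀ a s, ∀ x ∈ l a, height (f a s x) ≤ height s + G a) :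
    PolyTime fun a => (l a).foldl (f a) (b a) := by
  have bound (a : α) (l' : List γ) : ∀ s, l' ⊆ l a →
      height (l'.foldl (f a) s) ≤ height s + l'.length * G a := by
    induction l' with
    | nil => simp
    | cons x l' ih =>
      intro s h
      rw [List.cons_subset] at h
      have h₁ := hfG a s x h.1
      have h₂ := ih (f a s x) h.2
      rw [List.foldl_cons, List.length_cons, add_one_mul]
      omega
  refine foldl hf hb hl (B := fun a => height (b a) + height (l a) * G a) (by fun_prop)
    fun a l' hl' => (bound a l' _ hl'.subset).trans ?_
  gcongr
  exact hl'.length_le.trans (length_le_height _)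

@[fun_prop]
theorem replicate_false {n : α → ℕ} (hn : PolyTime n) :
    PolyTime fun a => List.replicate (n a) false :=
  hn.of_toDat_apply_eq fun _ => (toDat_replicate_false _).symm

theorem iterate {f : α → β → β} {b : α → β} {n : α → ℕ} {G : α → ℕ}
    (hf : PolyTime fun y : α × β => f y.1 y.2) (hb : PolyTime b) (hn : PolyTime n)
    (hG : PolyBounded G) (hfG : ∀ a s, height (f a s) ≤ height s + G a) :
    PolyTime fun a => (f a)^[n a] (b a) := by
  have hf' : PolyTime fun y : α × β × Bool => f y.1 y.2.1 := by fun_prop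
  refine (foldl_of_growth hf' hb hn.replicate_false hG
    fun a s _ _ => hfG a s).of_toDat_apply_eq fun a => ?_
  rw [List.foldl_const, List.length_replicate]

end PolyTime

section Library

variable {α β γ : Type} [ToDat α] [ToDat β] [ToDat γ]

theorem height_append_le (l l' : List α) : height (l ++ l') ≤ height l + height l' := by
  induction l with
  | nil => simp
  | cons a l ih => rw [List.cons_append, height_cons, height_cons]; omega

theorem height_le_of_sublist {l l' : List α} (h : l.Sublist l') : height l ≤ height l' := by
  induction h with
  | slnil => exact le_rfl
  | cons a _ ih => rw [height_cons]; omega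
  | cons_cons a _ ih => rw [height_cons, height_cons]; omega

theorem height_snd_le (x : α × β) : height x.2 ≤ height x := by
  cases x; simp only [height_pair]; omega

theorem toDat_eq_nil_iff {l : List α} : toDat l = .nil ↔ l = [] := by
  cases l <;> simp

namespace PolyTime

@[fun_prop]
theorem decide_not {p : α → Prop} [DecidablePred p] (hp : PolyTime fun a => decide (p a)) :
    PolyTime fun a => decide (¬ p a) := by
  have h : PolyTime fun a => if p a then false else true := by fun_prop
  exact h.of_toDat_apply_eq fun a => by by_cases h : p a <;> simp [h]

@[fun_prop]
theorem decide_and {p q : α → Prop} [DecidablePred p] [DecidablePred q]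
    (hp : PolyTime fun a => decide (p a)) (hq : PolyTime fun a => decide (q a)) :
    PolyTime fun a => decide (p a ∧ q a) := by
  have h : PolyTime fun a => if p a then decide (q a) else false := by fun_prop
  exact h.of_toDat_apply_eq fun a => by by_cases h : p a <;> simp [h]

@[fun_prop]
theorem decide_eq_true {f : α → Bool} (hf : PolyTime f) :
    PolyTime fun a => decide (f a = true) := by
  simpa only [Bool.decide_eq_true] using hf

@[fun_prop]
theorem not {f : α → Bool} (hf : PolyTime f) : PolyTime fun a => !f a := by
  have h : PolyTime fun a => decide (¬ f a = true) := by fun_prop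
  exact h.of_toDat_apply_eq fun a => by cases f a <;> rfl

@[fun_prop]
theorem xor {f g : α → Bool} (hf : PolyTime f) (hg : PolyTime g) :
    PolyTime fun a => f a ^^ g a := by
  have h : PolyTime fun a => if f a = true then !g a else g a := by fun_prop
  exact h.of_toDat_apply_eq fun a => by cases f a <;> simp

@[fun_prop]
theorem decide_eq_bool {f g : α → Bool} (hf : PolyTime f) (hg : PolyTime g) :
    PolyTime fun a => decide (f a = g a) := by
  have h : PolyTime fun a => !(f a ^^ g a) := by fun_prop
  exact h.of_toDat_apply_eq fun a => by cases f a <;> cases g a <;> rfl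

@[fun_prop]
theorem some {f : α → β} (hf : PolyTime f) : PolyTime fun a => Option.some (f a) :=
  ((PolyTime.const false).prodMk hf).of_toDat_apply_eq fun _ => rfl

@[fun_prop]
theorem or {f g : α → Option β} (hf : PolyTime f) (hg : PolyTime g) :
    PolyTime fun a => (f a).or (g a) := by
  have h : PolyTime fun a => (f a).isSome :=
    hf.of_toDat_eq_nil fun a => by cases f a <;> simp
  have h' : PolyTime fun a => if (f a).isSome = true then f a else g a := by fun_prop
  exact h'.of_toDat_apply_eq fun a => by cases f a <;> rfl

@[fun_prop]
theorem subtypeVal {p : α → Prop} {f : β → Subtype p} (hf : PolyTime f) :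
    PolyTime fun b => (f b).1 :=
  hf.of_toDat_apply_eq fun _ => rfl

@[fun_prop]
theorem cons {f : α → β} {l : α → List β} (hf : PolyTime f) (hl : PolyTime l) :
    PolyTime fun a => f a :: l a :=
  (hf.prodMk hl).of_toDat_apply_eq fun _ => rfl

@[fun_prop]
theorem tail {l : α → List β} (hl : PolyTime l) : PolyTime fun a => (l a).tail := by
  have h : PolyTime fun l : List β => l.tail :=
    of_expr (.tail (.var 0)) (fun l σ h => by cases l <;> simp [Expr.eval, h, Dat.tail])
      (PolyBounded.height_self.mono fun l => height_le_of_sublist l.tail_sublist)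
  exact h.comp hl

@[fun_prop]
theorem reverse {l : α → List β} (hl : PolyTime l) : PolyTime fun a => (l a).reverse := by
  have h : PolyTime fun a => (l a).foldl (fun s x => x :: s) [] :=
    foldl_of_growth (f := fun _ s x => x :: s) (by fun_prop) (by fun_prop) hl
      (G := fun a => height (l a) + 1) (by fun_prop) fun a s x hx => by
        have := height_le_of_mem hx
        rw [height_cons]; omega
  simpa only [List.foldl_flip_cons_eq_append, List.append_nil, List.map_id'] using h

@[fun_prop]
theorem append {l l' : α → List β} (hl : PolyTime l) (hl' : PolyTime l') :
    PolyTime fun a => l a ++ l' a := by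
  have h : PolyTime fun a => (l a).reverse.foldl (fun s x => x :: s) (l' a) :=
    foldl_of_growth (f := fun _ s x => x :: s) (by fun_prop) hl' (by fun_prop)
      (G := fun a => height (l a) + 1) (by fun_prop) fun a s x hx => by
        have := height_le_of_mem (List.mem_reverse.1 hx)
        rw [height_cons]; omega
  simpa using h

@[fun_prop]
theorem flatMap {f : α → β → List γ} {l : α → List β}
    (hf : PolyTime fun y : α × β => f y.1 y.2) (hl : PolyTime l) :
    PolyTime fun a => (l a).flatMap (f a) := by
  obtain ⟨p, hp⟩ := hf.2
  have h : PolyTime fun a => (l a).foldl (fun s x => s ++ f a x) [] :=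
    foldl_of_growth (f := fun a s x => s ++ f a x)
      ((by fun_prop : PolyTime fun y : α × List γ × β => y.2.1).append
        (hf.comp (by fun_prop : PolyTime fun y : α × List γ × β => (y.1, y.2.2)))) (by fun_prop) hl
      (G := fun a => p.eval (height a + height (l a) + 1))
      (by have := PolyBounded.height_self (α := α); fun_prop) fun a s x hx => by
        refine (height_append_le _ _).trans (Nat.add_le_add_left ((hp (a, x)).trans ?_) _)
        have := height_le_of_mem hx
        exact eval_mono p (by rw [height_pair]; omega)
  simpa only [← List.flatMap_eq_foldl] using h

@[fun_prop]
theorem map {f : α → β → γ} {l : α → List β}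
    (hf : PolyTime fun y : α × β => f y.1 y.2) (hl : PolyTime l) :
    PolyTime fun a => (l a).map (f a) := by
  have h : PolyTime fun a => (l a).flatMap fun x => [f a x] := by fun_prop
  simpa only [← List.map_eq_flatMap] using h

@[fun_prop]
theorem filter {p : α → β → Bool} {l : α → List β}
    (hp : PolyTime fun y : α × β => p y.1 y.2) (hl : PolyTime l) :
    PolyTime fun a => (l a).filter (p a) := by
  have h : PolyTime fun a => (l a).flatMap fun x => if p a x = true then [x] else [] := by fun_prop
  refine h.of_toDat_apply_eq fun a => congrArg toDat ?_
  induction l a with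
  | nil => rfl
  | cons x l ih => by_cases hx : p a x <;> simp [ih, hx]

@[fun_prop]
theorem any {p : α → β → Bool} {l : α → List β}
    (hp : PolyTime fun y : α × β => p y.1 y.2) (hl : PolyTime l) :
    PolyTime fun a => (l a).any (p a) :=
  (hp.filter hl).of_toDat_eq_nil fun a => by
    rw [toDat_eq_nil_iff, List.filter_eq_nil_iff, List.any_eq_false]

@[fun_prop]
theorem all {p : α → β → Bool} {l : α → List β}
    (hp : PolyTime fun y : α × β => p y.1 y.2) (hl : PolyTime l) :
    PolyTime fun a => (l a).all (p a) := by
  have h : PolyTime fun a => !(l a).any fun x => !p a x := by fun_prop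
  simpa only [← List.not_all_eq_any_not, Bool.not_not] using h

@[fun_prop]
theorem product {l : α → List β} {l' : α → List γ} (hl : PolyTime l) (hl' : PolyTime l') :
    PolyTime fun a => l a ×ˢ l' a := by
  have h : PolyTime fun a => (l a).flatMap fun x => (l' a).map fun y => (x, y) := by fun_prop
  exact h

@[fun_prop]
theorem length {l : α → List β} (hl : PolyTime l) : PolyTime fun a => (l a).length :=
  (by fun_prop : PolyTime fun a => (l a).map fun _ => false).of_toDat_apply_eq fun a => by
    rw [List.map_const', toDat_replicate_false]

@[fun_prop]
theorem drop {n : α → ℕ} {l : α → List β} (hn : PolyTime n) (hl : PolyTime l) :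
    PolyTime fun a => (l a).drop (n a) := by
  have h : PolyTime fun a => List.tail^[n a] (l a) :=
    iterate (f := fun _ => List.tail) (by fun_prop) hl hn (.const 0)
      fun _ s => height_le_of_sublist s.tail_sublist
  simpa only [List.tail_iterate] using h

theorem getD {n : α → ℕ} {l : α → List β} {b : β} (hb : toDat b = .nil) (hl : PolyTime l)
    (hn : PolyTime n) : PolyTime fun a => (l a).getD (n a) b := by
  have headD : PolyTime fun l : List β => l.getD 0 b := by
    refine of_expr (.head (.var 0)) (fun l σ h => ?_) (PolyBounded.height_self.mono fun l => ?_)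
    · cases l <;> simp [Expr.eval, h, Dat.head, hb]
    · cases l with
      | nil => simp [height, hb, Dat.height]
      | cons x l => exact height_le_of_mem (List.mem_cons_self ..)
  have h : PolyTime fun a => ((l a).drop (n a)).getD 0 b := by fun_prop
  refine h.of_toDat_apply_eq fun a => congrArg toDat ?_
  simp [List.getD_eq_getElem?_getD]

@[fun_prop]
theorem getD_false {n : α → ℕ} {l : α → List Bool} (hl : PolyTime l) (hn : PolyTime n) :
    PolyTime fun a => (l a).getD (n a) false :=
  getD toDat_false hl hn

@[fun_prop]
theorem getD_zero {n : α → ℕ} {l : α → List ℕ} (hl : PolyTime l) (hn : PolyTime n) :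
    PolyTime fun a => (l a).getD (n a) 0 :=
  getD toDat_zero hl hn

@[fun_prop]
theorem add {f g : α → ℕ} (hf : PolyTime f) (hg : PolyTime g) : PolyTime fun a => f a + g a := by
  have h : PolyTime fun a => List.replicate (f a) false ++ List.replicate (g a) false := by fun_prop
  exact h.of_toDat_apply_eq fun a => by rw [List.replicate_append_replicate, toDat_replicate_false]

@[fun_prop]
theorem mul {f g : α → ℕ} (hf : PolyTime f) (hg : PolyTime g) : PolyTime fun a => f a * g a := by
  have h : PolyTime fun a => (List.replicate (f a) false ×ˢ List.replicate (g a) false).length := by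
    fun_prop
  simpa only [List.length_product, List.length_replicate] using h

@[fun_prop]
theorem decide_le {f g : α → ℕ} (hf : PolyTime f) (hg : PolyTime g) :
    PolyTime fun a => decide (f a ≤ g a) := by
  have h : PolyTime fun a => (List.replicate (f a) false).drop (g a) := by fun_prop
  have h' : PolyTime fun a => decide (¬ f a ≤ g a) := h.of_toDat_eq_nil fun a => by
    simp [toDat_eq_nil_iff, Nat.sub_eq_zero_iff_le]
  simpa using h'.decide_not

@[fun_prop]
theorem decide_eq {f g : α → ℕ} (hf : PolyTime f) (hg : PolyTime g) :
    PolyTime fun a => decide (f a = g a) := by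
  have h : PolyTime fun a => decide (f a ≤ g a ∧ g a ≤ f a) := by fun_prop
  simpa only [le_antisymm_iff] using h

@[fun_prop]
theorem max {f g : α → ℕ} (hf : PolyTime f) (hg : PolyTime g) :
    PolyTime fun a => max (f a) (g a) := by
  have h : PolyTime fun a => if f a ≤ g a then g a else f a := by fun_prop
  simpa only [max_def] using h

@[fun_prop]
theorem min {f g : α → ℕ} (hf : PolyTime f) (hg : PolyTime g) :
    PolyTime fun a => min (f a) (g a) := by
  have h : PolyTime fun a => if f a ≤ g a then f a else g a := by fun_prop
  simpa only [min_def] using h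

@[fun_prop]
theorem decide_mem {f : α → ℕ} {l : α → List ℕ} (hf : PolyTime f) (hl : PolyTime l) :
    PolyTime fun a => decide (f a ∈ l a) := by
  have h : PolyTime fun a => (l a).any fun x => decide (f a = x) := by fun_prop
  exact h.of_toDat_apply_eq fun a => congrArg toDat (by rw [Bool.eq_iff_iff]; simp)

@[fun_prop]
theorem range {n : α → ℕ} (hn : PolyTime n) : PolyTime fun a => List.range (n a) := by
  have foldl_eq (l : List Bool) :
      l.foldl (fun s _ => s ++ [s.length]) [] = List.range l.length := by
    induction l using List.reverseRecOn with
    | nil => rfl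
    | append_singleton l b ih => simp [ih, List.range_succ]
  have h : PolyTime fun a =>
      (List.replicate (n a) false).foldl (fun s _ => s ++ [s.length]) ([] : List ℕ) := by
    refine foldl (f := fun _ s _ => s ++ [s.length]) (by fun_prop) (by fun_prop) (by fun_prop)
      (B := fun a => height (n a) + height (n a)) (by fun_prop) fun a l hl => ?_
    have hl := hl.length_le
    rw [List.length_replicate] at hl
    have := height_list_le (l := List.range l.length) (B := n a) fun k hk => by
      rw [height_nat]
      exact (List.mem_range.1 hk).le.trans hl
    rw [List.length_range] at this
    rw [foldl_eq, height_nat]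
    omega
  simpa only [foldl_eq, List.length_replicate] using h

@[fun_prop]
theorem choose_two {n : α → ℕ} (hn : PolyTime n) : PolyTime fun a => (n a).choose 2 := by
  have length_eq (k : ℕ) : ((List.range k).flatMap List.range).length = k.choose 2 := by
    induction k with
    | zero => rfl
    | succ k ih => simp [List.range_succ, ih, Nat.choose_succ_succ, add_comm]
  have h : PolyTime fun a => ((List.range (n a)).flatMap List.range).length := by fun_prop
  simpa only [length_eq] using h

end PolyTime

end Library

/-! ### Decision programs as subroutines -/

/-- A bound on the numbers of the variables in an expression. -/
def Expr.maxVar : Expr → ℕ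
  | .var x => x
  | .nil => 0
  | .cons e f => max e.maxVar f.maxVar
  | .head e => e.maxVar
  | .tail e => e.maxVar

/-- A bound on the numbers of the variables in a program. -/
def Cmd.maxVar : Cmd → ℕ
  | .assign x e => max x e.maxVar
  | .query x e => max x e.maxVar
  | .seq c d => max c.maxVar d.maxVar
  | .ite e c d => max e.maxVar (max c.maxVar d.maxVar)
  | .loop e c => max e.maxVar c.maxVar

theorem Expr.eval_congr {σ τ : Store} {e : Expr} (h : ∀ x ≤ e.maxVar, τ x = σ x) :
    e.eval τ = e.eval σ := by
  induction e with
  | var x => exact h x le_rfl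
  | nil => rfl
  | cons e f ihe ihf =>
    exact congrArg₂ Dat.cons (ihe fun x hx => h x (le_max_of_le_left hx))
      (ihf fun x hx => h x (le_max_of_le_right hx))
  | head e ih => exact congrArg Dat.head (ih h)
  | tail e ih => exact congrArg Dat.tail (ih h)

theorem Exec.of_noOracle {O : Oracle} {c : Cmd} {σ σ' : Store} {k k' t N j : ℕ}
    (h : Exec noOracle c σ k σ' k' t) (hN : c.maxVar ≤ N) {τ : Store} (hτ : ∀ x ≤ N, τ x = σ x) :
    ∃ τ', Exec O c τ j τ' j t ∧ (∀ x ≤ N, τ' x = σ' x) ∧ ∀ x, N < x → τ' x = τ x := by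
  have eval_eq {τ σ : Store} {e : Expr} (h : ∀ x ≤ N, τ x = σ x) (he : e.maxVar ≤ N) :
      e.eval τ = e.eval σ := Expr.eval_congr fun x hx => h x (hx.trans he)
  induction h generalizing τ with
  | assign x e =>
    simp only [Cmd.maxVar, max_le_iff] at hN
    refine ⟨_, .assign .., fun y hy => ?_, fun y hy => Function.update_of_ne (by omega) _ _⟩
    rw [eval_eq hτ hN.2, Function.update_apply, Function.update_apply, hτ y hy]
  | query _ _ _ _ _ h => exact h.elim
  | seq _ _ ih ih' =>
    simp only [Cmd.maxVar, max_le_iff] at hN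
    obtain ⟨τ₁, h₁, eq₁, frame₁⟩ := ih hN.1 hτ
    obtain ⟨τ₂, h₂, eq₂, frame₂⟩ := ih' hN.2 eq₁
    exact ⟨τ₂, h₁.seq h₂, eq₂, fun x hx => (frame₂ x hx).trans (frame₁ x hx)⟩
  | ite_true he _ ih =>
    simp only [Cmd.maxVar, max_le_iff] at hN
    obtain ⟨τ₁, h₁, eq_frame⟩ := ih hN.2.1 hτ
    exact ⟨τ₁, .ite_true (by rwa [eval_eq hτ hN.1]) h₁, eq_frame⟩
  | ite_false he _ ih =>
    simp only [Cmd.maxVar, max_le_iff] at hN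
    obtain ⟨τ₁, h₁, eq_frame⟩ := ih hN.2.2 hτ
    exact ⟨τ₁, .ite_false (by rwa [eval_eq hτ hN.1]) h₁, eq_frame⟩
  | loop_done he =>
    simp only [Cmd.maxVar, max_le_iff] at hN
    exact ⟨τ, .loop_done (by rwa [eval_eq hτ hN.1]), hτ, fun _ _ => rfl⟩
  | loop_step he _ _ ih ih' =>
    have hN' := hN
    simp only [Cmd.maxVar, max_le_iff] at hN'
    obtain ⟨τ₁, h₁, eq₁, frame₁⟩ := ih hN'.2 hτ
    obtain ⟨τ₂, h₂, eq₂, frame₂⟩ := ih' hN eq₁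
    exact ⟨τ₂, .loop_step (by rwa [eval_eq hτ hN'.1]) h₁ h₂, eq₂,
      fun x hx => (frame₂ x hx).trans (frame₁ x hx)⟩

/-- The program that sets the variables `1, …, N` to `nil`. -/
def Cmd.clear : ℕ → Cmd
  | 0 => .assign 0 (.var 0)
  | N + 1 => .seq (.assign (N + 1) .nil) (Cmd.clear N)

theorem Cmd.run_clear {O : Oracle} (N : ℕ) : ∀ σ : Store, Run O (Cmd.clear N) σ (N + 1) fun σ' =>
    (∀ x ≤ N, σ' x = Function.update (fun _ => Dat.nil) 0 (σ 0) x) ∧ ∀ x, N < x → σ' x = σ x := by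
  induction N with
  | zero =>
    refine fun σ => .assign ⟨fun x hx => ?_, fun x hx => Function.update_of_ne hx.ne' _ _⟩
    obtain rfl : x = 0 := by omega
    simp [Expr.eval]
  | succ N ih =>
    refine fun σ => (Run.assign_seq (ih _)).mono (by omega) fun σ' ⟨h, h'⟩ => ⟨fun x hx => ?_, ?_⟩
    · obtain rfl | hx := hx.eq_or_lt
      · simp [h', Expr.eval]
      · simp [h x (by omega)]
    · intro x hx
      rw [h' x (by omega), Function.update_of_ne (by omega)]

theorem Computes.run {O : Oracle} {c : Cmd} {d r : Dat} {t : ℕ} {σ : Store}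
    (h : Computes noOracle c d r t) (hσ : σ 0 = d) :
    Run O (.seq (.clear c.maxVar) c) σ (c.maxVar + 1 + t) (Returns c.maxVar r σ) := by
  obtain ⟨σ', k, h, rfl⟩ := h
  refine (Cmd.run_clear _ σ).seq fun τ ⟨hτ, frame⟩ j => ?_
  obtain ⟨τ', h', eq', frame'⟩ := h.of_noOracle (O := O) (j := j) le_rfl (by rwa [hσ] at hτ)
  exact ⟨τ', j, t, h', le_rfl, eq' 0 (by omega), fun x hx => (frame' x hx).trans (frame x hx)⟩

instance {k r : ℕ} : ToDat (Fin k → Fin r) := ⟨Dat.ofTuple⟩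

instance {α : Type} [ToDat α] {β : α → Type} [∀ a, ToDat (β a)] : ToDat (Σ a, β a) :=
  ⟨fun x => .cons (toDat x.1) (toDat x.2)⟩

open scoped Classical in
theorem DecidablePolyTime.polyTime {len : ℕ → ℕ} {f : ∀ n, (Fin (len n) → Fin 2) → Prop}
    (h : DecidablePolyTime len f) :
    PolyTime fun x : Σ n : {n : ℕ // 0 < n}, Fin (len n) → Fin 2 => decide (f x.1 x.2) := by
  obtain ⟨c, p, h⟩ := h
  refine ⟨⟨.seq (.seq (.clear c.maxVar) c) .toBool, c.maxVar,
    fun x => c.maxVar + 1 + p.eval (x.1 : ℕ) + 2, fun O ⟨n, a⟩ σ hσ => ?_, ?_⟩,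
    (PolyBounded.const 1).mono fun _ => height_bool_le _⟩
  · obtain ⟨t, r, hc, ht, hr⟩ := h n n.2 a
    refine ((hc.run hσ).mono (by gcongr) fun _ => id).seq fun σ' ⟨h0, frame⟩ => ?_
    refine (Cmd.run_toBool (by simpa [h0] using hr)).mono le_rfl fun τ ⟨h0', frame'⟩ => ⟨h0', ?_⟩
    exact fun x hx => (frame' x (by omega)).trans (frame x hx)
  · have : PolyBounded fun x : Σ n : {n : ℕ // 0 < n}, Fin (len n) → Fin 2 => (x.1 : ℕ) :=
      PolyBounded.height_self.mono fun x => by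
        rw [← height_nat (x.1 : ℕ)]
        exact (le_max_left _ _).trans (Nat.le_succ _)
    fun_prop

/-! ### Learning algorithms -/

/-- An algorithm for the hidden problem of `S` that keeps a state of type `τ`. As long as it does
not give up (`propose s = none`), it proposes an assignment, represented in the type `π`, and uses
the variables of the violated constraint to update the state. `Inv C r s` says that `s` is a
possible state of a run on the instance `C`, and that at most `r` further proposals will be
rejected. -/
structure Learner (S : CSP) (τ π : Type) [ToDat τ] [ToDat π] where
  init : {n : ℕ // 0 < n} → τ
  propose : τ → Option π
  update : (τ × π) × List ℕ → τ
  polyTime_init : PolyTime init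
  polyTime_propose : PolyTime propose
  polyTime_update : PolyTime update
  Inv : ∀ {n m : ℕ}, S.Instance n m → ℕ → τ → Prop
  bound : ℕ → ℕ
  polyBounded_bound : PolyBounded bound
  inv_init : ∀ (n : {n : ℕ // 0 < n}) {m : ℕ} (C : S.Instance n m), Inv C (bound n) (init n)
  height_le : ∀ {n m : ℕ} {C : S.Instance n m} {r : ℕ} {s : τ}, Inv C r s → height s ≤ bound n
  not_satisfies : ∀ {n m : ℕ} {C : S.Instance n m} {r : ℕ} {s : τ}, Inv C r s →
    propose s = none → ∀ a ∈ S.W n, ¬ CSP.Satisfies a C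
  inv_update : ∀ {n m : ℕ} {C : S.Instance n m} {r : ℕ} {s : τ} {z : π}, Inv C r s →
    propose s = some z → ∃ a ∈ S.W n, toDat z = Dat.ofTuple a ∧ ∀ j, ¬ (C j).Sat a →
      ∃ r' < r, Inv C r' (update ((s, z), List.ofFn fun i => ((C j).vars i : ℕ)))

namespace Learner

/-- The reaction to the oracle's answer in the variable `N + 3`, when the proposal stands in the
variable `0` and the state in the variable `N + 1`. The variable `N + 2` is set to `nil` at the end
of the run. -/
def react (cu : Cmd) (N : ℕ) : Cmd :=
  .ite (.var (N + 3))
    (.seq (.assign 0 (.cons (.cons (.var (N + 1)) (.tail (.var 0))) (.tail (.var (N + 3))))) <|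
      .seq cu (.assign (N + 1) (.var 0)))
    (.assign (N + 2) .nil)

/-- One proposal of a learner, given programs for `propose` and `update`. -/
def round (cp cu : Cmd) (N : ℕ) : Cmd :=
  .seq (.assign 0 (.var (N + 1))) <| .seq cp <| .ite (.var 0)
    (.seq (.query (N + 3) (.tail (.var 0))) (react cu N)) (.assign (N + 2) .nil)

/-- The program that executes a learner, given programs for its three functions. -/
def program (ci cp cu : Cmd) (N : ℕ) : Cmd :=
  .seq (.assign 0 (.head (.var 0))) <| .seq ci <| .seq (.assign (N + 1) (.var 0)) <|
    .seq (.assign (N + 2) (.cons .nil .nil)) <| .loop (.var (N + 2)) (round cp cu N)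

variable {S : CSP} {τ π : Type} [ToDat τ] [ToDat π] (L : Learner S τ π)

/-- The run has reached the state `s`. -/
def InState (N : ℕ) (s : τ) (σ : Store) : Prop := σ (N + 1) = toDat s ∧ σ (N + 2) ≠ .nil

/-- The run has finished with the output of a solution. -/
def Finished {n m : ℕ} (C : S.Instance n m) (N : ℕ) (σ : Store) : Prop :=
  σ (N + 2) = .nil ∧ ∃ out, σ 0 = CSP.encodeOutput out ∧ CSP.IsSolution C out

/-- The effect of a proposal, if at most `r` further proposals will be rejected. -/
def Progress {n m : ℕ} (C : S.Instance n m) (N r : ℕ) (σ : Store) : Prop :=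
  Finished C N σ ∨ ∃ r' < r, ∃ s, L.Inv C r' s ∧ InState N s σ

variable {L} {n m : ℕ} {C : S.Instance n m} {V : ℕ → S.Assignment n → S.Answer n m} {cp cu : Cmd}
  {N K r : ℕ} {Tp : τ → ℕ} {Tu : (τ × π) × List ℕ → ℕ} {O : Oracle} {s : τ} {σ : Store}

theorem run_finish {out : Option (S.Assignment n)} (h0 : σ 0 = CSP.encodeOutput out)
    (hout : CSP.IsSolution C out) : Run O (.assign (N + 2) .nil) σ 1 (L.Progress C N r) :=
  .assign (.inl ⟨by simp [Expr.eval], out, by simpa, hout⟩)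

theorem run_react (hu : Implements cu N L.update Tu) {z : π} {a : S.Assignment n} (ha : a ∈ S.W n)
    (hza : toDat z = Dat.ofTuple a) (hviol : ∀ j, ¬ (C j).Sat a →
      Tu ((s, z), List.ofFn fun i => ((C j).vars i : ℕ)) ≤ K ∧
        ∃ r' < r, L.Inv C r' (L.update ((s, z), List.ofFn fun i => ((C j).vars i : ℕ))))
    {ans : S.Answer n m} (hans : CSP.CorrectAnswer C a ans) (hσ : InState N s σ)
    (h0 : σ 0 = toDat (some z)) (hσans : σ (N + 3) = CSP.encodeAnswer ans) :
    Run O (react cu N) σ (K + 3) (L.Progress C N r) := by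
  rcases ans with _ | ⟨j, v⟩
  · have hout : σ 0 = CSP.encodeOutput (some a) := by rw [h0, toDat_some, hza]; rfl
    exact (Run.ite_false (by exact hσans) (run_finish hout ⟨ha, hans⟩)).mono (by omega) fun _ => id
  · obtain ⟨hj, rfl⟩ := hans
    obtain ⟨hK, r', hr', hinv⟩ := hviol j hj
    rw [CSP.encodeAnswer, ← toDat_ofFn_val] at hσans
    set v := List.ofFn fun i => ((C j).vars i : ℕ)
    have htest : (Expr.var (N + 3)).eval σ ≠ .nil := by simp [Expr.eval, hσans]
    refine Run.mono (.ite_true htest (.assign_seq ((hu O ((s, z), v) _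
      (by simp [Expr.eval, h0, hσ.1, hσans, Dat.tail])).seq fun σ' ⟨h0', frame⟩ =>
        .assign (.inr ⟨r', hr', _, hinv, by simp [Expr.eval, h0'], ?_⟩)))) (by omega) fun _ => id
    rw [Function.update_of_ne (by omega), frame _ (by omega), Function.update_of_ne (by omega)]
    exact hσ.2

theorem run_round (hV : CSP.IsRevealing C V) (hp : Implements cp N L.propose Tp)
    (hu : Implements cu N L.update Tu) (hs : L.Inv C r s) (hTp : Tp s ≤ K)
    (hTu : ∀ z j, L.propose s = some z →
      Tu ((s, z), List.ofFn fun i => ((C j).vars i : ℕ)) ≤ K) (hσ : InState N s σ) :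
    Run (CSP.oracle V) (round cp cu N) σ (2 * K + 7) (L.Progress C N r) := by
  refine (Run.assign_seq ((hp _ s _ (by simpa [Expr.eval] using hσ.1)).seq fun σ₁ ⟨h0, frame⟩ =>
    (?_ : Run _ _ _ (K + 5) (L.Progress C N r)))).mono (by omega) fun _ => id
  have hσ₁ : InState N s σ₁ := by
    unfold InState
    rwa [frame _ (by omega), frame _ (by omega), Function.update_of_ne (by omega),
      Function.update_of_ne (by omega)]
  cases hz : L.propose s with
  | none =>
    rw [hz] at h0
    exact (Run.ite_false (by exact h0) (run_finish (out := none) h0 (L.not_satisfies hs hz))).mono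
      (by omega) fun _ => id
  | some z =>
    rw [hz] at h0
    obtain ⟨a, ha, hza, hviol⟩ := L.inv_update hs hz
    have hquery : Run (CSP.oracle V) (.query (N + 3) (.tail (.var 0))) σ₁ 1 fun σ₂ =>
        ∃ ans, CSP.CorrectAnswer C a ans ∧
          σ₂ = Function.update σ₁ (N + 3) (CSP.encodeAnswer ans) :=
      .query fun k => ⟨_, ⟨a, ha, by simp [Expr.eval, h0, Dat.tail, hza], rfl⟩, _, hV k a ha, rfl⟩
    refine (Run.ite_true (by simp [Expr.eval, h0]) (hquery.seq ?_)).mono (T := 1 + (K + 3) + 1)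
      (by omega) fun _ => id
    rintro σ₂ ⟨ans, hans, rfl⟩
    refine run_react hu ha hza (fun j hj => ⟨hTu z j hz, hviol j hj⟩) hans ?_ ?_ (by simp)
    · unfold InState
      rwa [Function.update_of_ne (by omega), Function.update_of_ne (by omega)]
    · rwa [Function.update_of_ne (by omega)]

theorem run_loop (hV : CSP.IsRevealing C V) (hp : Implements cp N L.propose Tp)
    (hu : Implements cu N L.update Tu) (hTp : ∀ {r s}, L.Inv C r s → Tp s ≤ K)
    (hTu : ∀ {r s z j}, L.Inv C r s → L.propose s = some z →
      Tu ((s, z), List.ofFn fun i => ((C j).vars i : ℕ)) ≤ K) (hs : L.Inv C r s)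
    (hσ : InState N s σ) : Run (CSP.oracle V) (.loop (.var (N + 2)) (round cp cu N)) σ
      ((r + 1) * (2 * K + 8) + 1) (Finished C N) := by
  induction r using Nat.strong_induction_on generalizing s σ with
  | _ r ih =>
    refine (Run.loop_step (by exact hσ.2) (run_round hV hp hu hs (hTp hs) (fun _ _ => hTu hs) hσ)
      (T' := r * (2 * K + 8) + 1) ?_).mono (by linarith) fun _ => id
    rintro σ' (done | ⟨r', hr', s', hs', hσ'⟩)
    · exact (Run.loop_done (by exact done.1) done).mono (by omega) fun _ => id
    · exact (ih r' hr' hs' hσ').mono (by gcongr; omega) fun _ => id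

theorem exists_polyBounded_time (hlen : PolyBounded S.len) (hTp : PolyBounded Tp)
    (hTu : PolyBounded Tu) :
    ∃ K : ℕ → ℕ, PolyBounded K ∧ ∀ {n m : ℕ} {C : S.Instance n m} {r : ℕ} {s : τ},
      L.Inv C r s → Tp s ≤ K n ∧ ∀ z j, L.propose s = some z →
        Tu ((s, z), List.ofFn fun i => ((C j).vars i : ℕ)) ≤ K n := by
  obtain ⟨⟨pz, hpz⟩, ⟨pp, hpp⟩, pu, hpu⟩ := And.intro L.polyTime_propose.2 (And.intro hTp hTu)
  have hbound := L.polyBounded_bound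
  refine ⟨fun n => pp.eval (L.bound n) +
    pu.eval (L.bound n + pz.eval (L.bound n) + (S.len n + S.len n) + 2), by fun_prop, ?_⟩
  refine fun {n m C r s} hs => ⟨?_, fun z j hz => ?_⟩
  · exact (hpp s).trans ((eval_mono pp (L.height_le hs)).trans (Nat.le_add_right _ _))
  · have hz' : height z + 1 ≤ pz.eval (L.bound n) := by
      simpa [hz] using (hpz s).trans (eval_mono pz (L.height_le hs))
    have hv : height (List.ofFn fun i => ((C j).vars i : ℕ)) ≤ S.len n + S.len n := by
      refine (height_list_le (B := S.len n) fun x hx => ?_).trans ?_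
      · obtain ⟨i, rfl⟩ := (List.mem_ofFn' _ _).mp hx
        simp
      · simpa using Fintype.card_le_of_embedding (C j).vars
    refine (hpu _).trans ((eval_mono pu ?_).trans (Nat.le_add_left _ _))
    have := L.height_le hs
    simp only [height_pair]
    omega

theorem hiddenPolyTime (L : Learner S τ π) (hlen : PolyBounded S.len) : S.HiddenPolyTime := by
  obtain ⟨⟨ci, Ni, Ti, hi, pi, hpi⟩, -⟩ := L.polyTime_init
  obtain ⟨⟨cp, Np, Tp, hp, hTp⟩, -⟩ := L.polyTime_propose
  obtain ⟨⟨cu, Nu, Tu, hu, hTu⟩, -⟩ := L.polyTime_update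
  obtain ⟨K, hK, hKle⟩ := exists_polyBounded_time hlen hTp hTu
  set N := max Ni (max Np Nu)
  obtain ⟨P, hP⟩ : PolyBounded fun n : ℕ =>
      pi.eval n + ((L.bound n + 1) * (2 * K n + 8) + 4) := by
    have hbound := L.polyBounded_bound
    refine (PolyBounded.eval pi ?_).add (by fun_prop)
    exact PolyBounded.height_self.mono fun n => (height_nat n).ge
  refine ⟨program ci cp cu N, P, fun n m hn C V hV => ?_⟩
  have hrun : Run (CSP.oracle V) (program ci cp cu N)
      (Function.update (fun _ => Dat.nil) 0 (.cons (Dat.ofNat n) (Dat.ofNat m)))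
      (pi.eval n + ((L.bound n + 1) * (2 * K n + 8) + 4)) (Finished C N) := by
    refine Run.mono (.assign_seq ((hi.mono (N' := N) (le_max_left _ _) _ ⟨n, hn⟩ _ rfl).seq
      fun σ₁ ⟨h0, _⟩ => .assign_seq (.assign_seq (run_loop hV (hp.mono (by simp [N]))
        (hu.mono (by simp [N])) (fun hs => (hKle hs).1) (fun hs => (hKle hs).2 _ _)
        (L.inv_init ⟨n, hn⟩ C) ?_)))) ?_ fun _ => id
    · simp [InState, Expr.eval, h0]
    · have := hpi ⟨n, hn⟩
      simp only [height_subtype, height_nat] at this ⊢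
      omega
  obtain ⟨σ, k, t, hexec, ht, -, out, h0, hout⟩ := hrun 0
  refine ⟨t, out, ⟨σ, k, hexec, h0⟩, ht.trans ((hP n).trans (eval_mono P ?_)), hout⟩
  rw [height_nat, CSP.size, add_assoc]
  exact Nat.le_add_right _ _

end Learner

/-! ### Reachability -/

theorem isFixedPt_iterate_of_lt {α : Type*} {f : α → α} {μ : α → ℕ}
    (h : ∀ x, f x = x ∨ μ (f x) < μ x) {n : ℕ} {x : α} (hx : μ x ≤ n) :
    Function.IsFixedPt f (f^[n] x) := by
  induction n generalizing x with
  | zero => exact (h x).resolve_right (by omega)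
  | succ n ih =>
    rw [Function.iterate_succ_apply]
    rcases h x with hfix | hlt
    · rw [hfix]
      exact (Function.iterate_fixed hfix n).symm ▸ hfix
    · exact ih (by omega)

/-- The closure of the set `l` under one application of each of the `rules`, where a rule `(p, q)`
puts `q` into a set that contains `p`. -/
def pass (rules : List (ℕ × ℕ)) (l : List ℕ) : List ℕ :=
  (rules.filter fun r => r.1 ∈ l ∧ r.2 ∉ l).map Prod.snd ++ l

/-- The set of the numbers that are reachable from `s` by the `rules`. -/
def reach (rules : List (ℕ × ℕ)) (s : ℕ) : List ℕ := (pass rules)^[rules.length] [s]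

theorem mem_pass {rules : List (ℕ × ℕ)} {l : List ℕ} {q : ℕ} :
    q ∈ pass rules l ↔ (∃ p ∈ l, (p, q) ∈ rules) ∨ q ∈ l := by
  by_cases hq : q ∈ l
  · simp [pass, hq]
  · simp [pass, hq, and_comm]

theorem pass_eq_self_or_card_lt (rules : List (ℕ × ℕ)) (l : List ℕ) :
    pass rules l = l ∨ ((rules.map Prod.snd).toFinset \ (pass rules l).toFinset).card <
      ((rules.map Prod.snd).toFinset \ l.toFinset).card := by
  by_cases h : ∃ r ∈ rules, r.1 ∈ l ∧ r.2 ∉ l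
  · obtain ⟨r, hr, hr₁, hr₂⟩ := h
    refine .inr (Finset.card_lt_card (Finset.ssubset_iff_of_subset ?_ |>.2 ⟨r.2, ?_, ?_⟩))
    · exact Finset.sdiff_subset_sdiff le_rfl fun q hq => by simp_all [mem_pass]
    · simpa [hr₂] using ⟨r.1, hr⟩
    · have : r.2 ∈ pass rules l := mem_pass.2 (.inl ⟨r.1, hr₁, hr⟩)
      simp [this]
  · left
    simpa [pass, List.filter_eq_nil_iff] using h

theorem mem_reach {rules : List (ℕ × ℕ)} {s k : ℕ} :
    k ∈ reach rules s ↔ Relation.ReflTransGen (fun p q => (p, q) ∈ rules) s k := by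
  have fixed : pass rules (reach rules s) = reach rules s :=
    isFixedPt_iterate_of_lt (μ := fun l => ((rules.map Prod.snd).toFinset \ l.toFinset).card)
      (pass_eq_self_or_card_lt rules) <| (Finset.card_le_card Finset.sdiff_subset).trans <|
      (List.toFinset_card_le _).trans (List.length_map _).le
  constructor
  · have sound (i : ℕ) : ∀ k ∈ (pass rules)^[i] [s],
        Relation.ReflTransGen (fun p q => (p, q) ∈ rules) s k := by
      induction i with
      | zero => simp [Relation.ReflTransGen.refl]
      | succ i ih =>
        intro k hk
        rw [Function.iterate_succ_apply', mem_pass] at hk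
        obtain ⟨p, hp, hpk⟩ | hk := hk
        exacts [(ih p hp).tail hpk, ih k hk]
    exact sound _ k
  · intro h
    induction h with
    | refl =>
      have mono (i : ℕ) : s ∈ (pass rules)^[i] [s] := by
        induction i with
        | zero => simp
        | succ i ih => rw [Function.iterate_succ_apply', mem_pass]; exact .inr ih
      exact mono _
    | tail _ hpq ih => rw [← fixed, mem_pass]; exact .inl ⟨_, ih, hpq⟩

@[fun_prop]
theorem polyTime_reach {α : Type} [ToDat α] {rules : α → List (ℕ × ℕ)} {s : α → ℕ}
    (hrules : PolyTime rules) (hs : PolyTime s) : PolyTime fun a => reach (rules a) (s a) := by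
  have growth (a : α) (l : List ℕ) :
      height (pass (rules a) l) ≤ height l + 2 * height (rules a) := by
    set fired := (rules a).filter fun r => r.1 ∈ l ∧ r.2 ∉ l with hfired
    have hsub : fired.Sublist (rules a) := List.filter_sublist
    have hmap : height (fired.map Prod.snd) ≤ height (rules a) + (fired.map Prod.snd).length :=
      height_list_le fun q hq => by
        obtain ⟨r, hr, rfl⟩ := List.mem_map.1 hq
        exact (height_snd_le r).trans (height_le_of_mem (hsub.subset hr))
    have happend := height_append_le (fired.map Prod.snd) l
    have hlength := hsub.length_le.trans (length_le_height _)
    rw [List.length_map] at hmap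
    rw [pass, ← hfired]
    omega
  refine PolyTime.iterate (f := fun a => pass (rules a)) ?_ (by fun_prop) (by fun_prop) ?_ growth
  · unfold pass
    fun_prop
  · exact (PolyBounded.const 2).mul hrules.2

/-! ### Forbidden patterns -/

/-- The assignment that is represented by a list of Booleans. -/
def bits (k : ℕ) (l : List Bool) : Fin k → Fin 2 := fun i => if l.getD i false then 1 else 0

theorem toDat_eq_ofTuple_bits {k : ℕ} {l : List Bool} (h : l.length = k) :
    toDat l = Dat.ofTuple (bits k l) := by
  subst h
  have hl : List.ofFn (fun i : Fin l.length => l.getD i false) = l :=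
    List.ext_getElem (by simp) fun i _ hi => by simp
  conv_lhs => rw [← hl]
  change Dat.ofList (List.map toDat _) = _
  rw [List.map_ofFn, Dat.ofTuple]
  congr 2
  funext i
  simp only [Function.comp_apply, bits]
  cases l.getD i false <;> rfl

theorem exists_bits_eq {k : ℕ} (a : Fin k → Fin 2) : ∃ l, bits k l = a := by
  refine ⟨List.ofFn fun i => decide (a i = 1), funext fun i => ?_⟩
  simp only [bits, List.getD_eq_getElem?_getD, List.getElem?_ofFn, i.2]
  grind

theorem getD_map_range {k i : ℕ} (p : ℕ → Bool) (hi : i < k) :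
    ((List.range k).map p).getD i false = p i := by
  simp [hi]

/-- A forbidden pattern `((i, j), (x, y))` excludes the assignments with the values `x` and `y` in
the positions `i` and `j`. -/
abbrev Pattern : Type := (ℕ × ℕ) × (Bool × Bool)

namespace Pattern

/-- The assignment `a` is excluded by the pattern `p`. -/
def Matches (p : Pattern) (a : List Bool) : Prop :=
  a.getD p.1.1 false = p.2.1 ∧ a.getD p.1.2 false = p.2.2

instance (p : Pattern) (a : List Bool) : Decidable (p.Matches a) :=
  inferInstanceAs (Decidable (_ ∧ _))

/-- The rules `(k, l)` saying that an assignment that avoids the patterns `F` and differs from `a`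
in `k` also differs from `a` in `l`. -/
def rules (F : List Pattern) (a : List Bool) : List (ℕ × ℕ) :=
  (F.filter fun p => ¬ a.getD p.1.1 false = p.2.1 ∧ a.getD p.1.2 false = p.2.2).map
      (fun p => (p.1.1, p.1.2)) ++
    (F.filter fun p => a.getD p.1.1 false = p.2.1 ∧ ¬ a.getD p.1.2 false = p.2.2).map
      (fun p => (p.1.2, p.1.1))

/-- The assignment obtained from `a` by flipping the value in position `i` and the values whose
flips are forced by the patterns `F`. -/
def flip (F : List Pattern) (a : List Bool) (i : ℕ) : List Bool :=
  (List.range a.length).map fun k => a.getD k false ^^ decide (k ∈ reach (rules F a) i)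

/-- An assignment that avoids `F` and differs from `a` in position `i`. -/
def repair (F : List Pattern) (a : List Bool) (i : ℕ) : Option (List Bool) :=
  if F.all fun p => !decide (p.Matches (flip F a i)) then some (flip F a i) else none

variable {F : List Pattern} {a b z : List Bool} {i k l : ℕ}

theorem getD_ne_of_mem_reach (hz : ∀ p ∈ F, ¬ p.Matches z)
    (hi : z.getD i false ≠ a.getD i false) (hk : k ∈ reach (rules F a) i) :
    z.getD k false ≠ a.getD k false := by
  have step : ∀ x₁ x₂ y₁ y₂ w₁ w₂ : Bool, x₁ ≠ y₁ → ¬ (x₁ = w₁ ∧ x₂ = w₂) →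
    ¬ y₁ = w₁ ∧ y₂ = w₂ → x₂ ≠ y₂ := by decide
  rw [mem_reach] at hk
  induction hk with
  | refl => exact hi
  | tail _ hkl ih =>
    simp only [rules, List.mem_append, List.mem_map, List.mem_filter, Prod.mk.injEq,
      decide_eq_true_eq] at hkl
    obtain ⟨p, ⟨hp, hpa⟩, rfl, rfl⟩ | ⟨p, ⟨hp, hpa⟩, rfl, rfl⟩ := hkl
    · exact step _ _ _ _ _ _ ih (hz p hp) hpa
    · exact step _ _ _ _ _ _ ih (mt And.symm (hz p hp)) hpa.symm

theorem not_matches_flip (hF : ∀ p ∈ F, p.1.1 < a.length ∧ p.1.2 < a.length)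
    (ha : ∀ p ∈ F, p.Matches a → p.1.1 = i ∨ p.1.2 = i) (hz : ∀ p ∈ F, ¬ p.Matches z)
    (hi : z.getD i false ≠ a.getD i false) : ∀ p ∈ F, ¬ p.Matches (flip F a i) := by
  intro p hp hmatch
  have reach_snd (h : ¬ a.getD p.1.1 false = p.2.1 ∧ a.getD p.1.2 false = p.2.2)
      (hr : p.1.1 ∈ reach (rules F a) i) : p.1.2 ∈ reach (rules F a) i :=
    mem_reach.2 ((mem_reach.1 hr).tail (by simp only [rules]; grind))
  have reach_fst (h : a.getD p.1.1 false = p.2.1 ∧ ¬ a.getD p.1.2 false = p.2.2)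
      (hr : p.1.2 ∈ reach (rules F a) i) : p.1.1 ∈ reach (rules F a) i :=
    mem_reach.2 ((mem_reach.1 hr).tail (by simp only [rules]; grind))
  unfold Matches at hmatch
  rw [flip, getD_map_range _ (hF p hp).1, getD_map_range _ (hF p hp).2] at hmatch
  by_cases h₁ : p.1.1 ∈ reach (rules F a) i <;> by_cases h₂ : p.1.2 ∈ reach (rules F a) i <;>
    simp only [h₁, h₂, decide_true, decide_false, Bool.xor_true, Bool.xor_false] at hmatch
  · have hz₁ := Bool.eq_not.2 (getD_ne_of_mem_reach hz hi h₁)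
    have hz₂ := Bool.eq_not.2 (getD_ne_of_mem_reach hz hi h₂)
    exact hz p hp ⟨hz₁.trans hmatch.1, hz₂.trans hmatch.2⟩
  · exact h₂ (reach_snd ⟨Bool.eq_not.1 hmatch.1.symm |>.symm, hmatch.2⟩ h₁)
  · exact h₁ (reach_fst ⟨hmatch.1, Bool.eq_not.1 hmatch.2.symm |>.symm⟩ h₂)
  · have hstart : i ∈ reach (rules F a) i := mem_reach.2 .refl
    obtain hpi | hpi := ha p hp hmatch
    exacts [h₁ (hpi ▸ hstart), h₂ (hpi ▸ hstart)]

theorem repair_eq_some (h : repair F a i = some b) :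
    b.length = a.length ∧ ∀ p ∈ F, ¬ p.Matches b := by
  unfold repair at h
  split_ifs at h with hall
  obtain rfl := Option.some.inj h
  exact ⟨by simp [flip], by simpa using hall⟩

theorem getD_eq_of_repair_eq_none (h : repair F a i = none)
    (hF : ∀ p ∈ F, p.1.1 < a.length ∧ p.1.2 < a.length)
    (ha : ∀ p ∈ F, p.Matches a → p.1.1 = i ∨ p.1.2 = i) (hz : ∀ p ∈ F, ¬ p.Matches z) :
    z.getD i false = a.getD i false := by
  by_contra hi
  have := not_matches_flip hF ha hz hi
  unfold repair at h
  simp_all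

theorem length_le_of_nodup {n : ℕ} (hnodup : F.Nodup) (hF : ∀ p ∈ F, p.1.1 < n ∧ p.1.2 < n) :
    F.length ≤ 4 * (n * n) := by
  have hsub : F.toFinset ⊆ (Finset.range n ×ˢ Finset.range n) ×ˢ Finset.univ := fun p hp => by
    simpa using hF p (List.mem_toFinset.1 hp)
  have := Finset.card_le_card hsub
  rw [List.toFinset_card_of_nodup hnodup] at this
  simpa [mul_comm] using this

theorem polyTime_repair {α : Type} [ToDat α] {F : α → List Pattern} {a : α → List Bool}
    {i : α → ℕ} (hF : PolyTime F) (ha : PolyTime a) (hi : PolyTime i) :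
    PolyTime fun x => repair (F x) (a x) (i x) := by
  unfold repair Matches flip rules
  fun_prop

end Pattern

/-! ### Binary Boolean constraints -/

/-- The state in the search for an assignment: the patterns excluded by the answers so far, and the
next proposal, if there is one. -/
abbrev PatternState : Type := List Pattern × Option (List Bool)

namespace PatternState

/-- After a proposal `z` that violates a constraint on the positions `v`, every solution avoids the
pattern of `z` in these positions, and hence differs from `z` in one of them. -/
def update (x : (PatternState × List Bool) × List ℕ) : PatternState :=
  let z := x.1.2
  let i := x.2.getD 0 0
  let j := x.2.getD 1 0
  let F : List Pattern := ((i, j), (z.getD i false, z.getD j false)) :: x.1.1.1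
  (F, (Pattern.repair F z i).or (Pattern.repair F z j))

theorem polyTime_update : PolyTime update := by
  have hrepair {α : Type} [ToDat α] {F : α → List Pattern} {a : α → List Bool} {i : α → ℕ} :=
    Pattern.polyTime_repair (F := F) (a := a) (i := i)
  unfold update
  fun_prop

/-- The possible states of a run on `C` in which at most `r` further proposals are rejected. -/
structure Inv {R : ℕ → Set (Set (Fin 2 → Fin 2))} {n m : ℕ} (C : (binaryBoolean R).Instance n m)
    (r : ℕ) (s : PatternState) : Prop where
  nodup : s.1.Nodup
  lt : ∀ p ∈ s.1, p.1.1 < n ∧ p.1.2 < n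
  not_matches : ∀ z, CSP.Satisfies (S := binaryBoolean R) (bits n z) C → ∀ p ∈ s.1, ¬ p.Matches z
  candidate : ∀ a ∈ s.2, a.length = n ∧ ∀ p ∈ s.1, ¬ p.Matches a
  not_satisfies : s.2 = none → ∀ z, ¬ CSP.Satisfies (S := binaryBoolean R) (bits n z) C
  rank : 4 * (n * n) < s.1.length + r

variable {R : ℕ → Set (Set (Fin 2 → Fin 2))} {n m r : ℕ} {C : (binaryBoolean R).Instance n m}
  {s : PatternState} {z : List Bool}

theorem Inv.height_le (h : Inv C r s) : height s ≤ 4 * (n * n) + n + 5 := by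
  have hF : height s.1 ≤ n + 2 + s.1.length := height_list_le fun p hp => by
    have := h.lt p hp
    have := height_bool_le p.2.1
    have := height_bool_le p.2.2
    calc height p = max (max p.1.1 p.1.2 + 1) (max (height p.2.1) (height p.2.2) + 1) + 1 := by
          rw [← height_nat p.1.1, ← height_nat p.1.2]; rfl
      _ ≤ n + 2 := by omega
  have hlen := Pattern.length_le_of_nodup h.nodup h.lt
  have ha : height s.2 ≤ n + 2 := by
    cases hs : s.2 with
    | none => simp
    | some a =>
      have := height_listBool_le a
      have := (h.candidate a hs).1
      rw [height_some]
      omega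
  change max (height s.1) (height s.2) + 1 ≤ _
  omega

theorem Inv.cons (h : Inv C r s) (hz : s.2 = some z) {p : Pattern} (hp : p.1.1 < n ∧ p.1.2 < n)
    (hpz : p.Matches z)
    (sound : ∀ b, CSP.Satisfies (S := binaryBoolean R) (bits n b) C → ¬ p.Matches b) :
    ∃ r' < r, Inv C r'
      (p :: s.1, (Pattern.repair (p :: s.1) z p.1.1).or (Pattern.repair (p :: s.1) z p.1.2)) := by
  obtain ⟨rfl, hzF⟩ := h.candidate z hz
  have hlt : ∀ q ∈ p :: s.1, q.1.1 < z.length ∧ q.1.2 < z.length :=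
    List.forall_mem_cons.2 ⟨hp, h.lt⟩
  have hnodup : (p :: s.1).Nodup := h.nodup.cons fun hmem => hzF p hmem hpz
  have sound b (hb : CSP.Satisfies (S := binaryBoolean R) (bits z.length b) C) :
      ∀ q ∈ p :: s.1, ¬ q.Matches b := List.forall_mem_cons.2 ⟨sound b hb, h.not_matches b hb⟩
  have eq_of_matches : ∀ q ∈ p :: s.1, q.Matches z → q = p :=
    List.forall_mem_cons.2 ⟨fun _ => rfl, fun q hq hqz => absurd hqz (hzF q hq)⟩
  have hlength := Pattern.length_le_of_nodup hnodup hlt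
  have hrank := h.rank
  rw [List.length_cons] at hlength
  refine ⟨r - 1, by omega, hnodup, hlt, sound, fun a ha => ?_, fun hnone b hb => ?_, ?_⟩
  · obtain ha | ⟨-, ha⟩ := Option.or_eq_some_iff.1 ha
    exacts [Pattern.repair_eq_some ha, Pattern.repair_eq_some ha]
  · obtain ⟨h₁, h₂⟩ := Option.or_eq_none_iff.1 hnone
    have h₁ := Pattern.getD_eq_of_repair_eq_none h₁ hlt
      (fun q hq hqz => .inl (by rw [eq_of_matches q hq hqz])) (sound b hb)
    have h₂ := Pattern.getD_eq_of_repair_eq_none h₂ hlt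
      (fun q hq hqz => .inr (by rw [eq_of_matches q hq hqz])) (sound b hb)
    exact sound b hb p List.mem_cons_self ⟨h₁.trans hpz.1, h₂.trans hpz.2⟩
  · rw [List.length_cons]
    omega

theorem Inv.update (h : Inv C r s) (hz : s.2 = some z) {j : Fin m} (hj : ¬ (C j).Sat (bits n z)) :
    ∃ r' < r, Inv C r' (update ((s, z), List.ofFn fun i => ((C j).vars i : ℕ))) := by
  set i₀ := (C j).vars (0 : Fin 2)
  set i₁ := (C j).vars (1 : Fin 2)
  refine h.cons hz (p := ((i₀, i₁), (z.getD i₀ false, z.getD i₁ false))) ⟨i₀.2, i₁.2⟩ ⟨rfl, rfl⟩ ?_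
  rintro b hb ⟨h₀, h₁⟩
  have agree : ∀ i : Fin 2, bits n z ((C j).vars i) = bits n b ((C j).vars i) :=
    Fin.forall_fin_two.2 ⟨by simp only [bits]; rw [h₀], by simp only [bits]; rw [h₁]⟩
  exact hj ((congrArg (· ∈ (C j).rel) (funext agree)).mpr (hb j))

/-- The learner that repairs the last proposal by flipping one of the positions of the violated
constraint, together with the positions whose flips this forces. -/
def learner (R : ℕ → Set (Set (Fin 2 → Fin 2))) :
    Learner (binaryBoolean R) PatternState (List Bool) where
  init n := ([], some (List.replicate n false))
  propose s := s.2
  update := PatternState.update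
  polyTime_init := by fun_prop
  polyTime_propose := by fun_prop
  polyTime_update := polyTime_update
  Inv := Inv
  bound n := 4 * (n * n) + n + 5
  polyBounded_bound := (((PolyBounded.const 4).mul (.mul .id .id)).add .id).add (.const 5)
  inv_init n m C :=
    { nodup := List.nodup_nil
      lt := by simp
      not_matches := by simp
      candidate := by simp
      not_satisfies := by simp
      rank := by simp only [List.length_nil]; omega }
  height_le := Inv.height_le
  not_satisfies h hnone a _ := by
    obtain ⟨z, rfl⟩ := exists_bits_eq a
    exact h.not_satisfies hnone z
  inv_update h hz :=
    ⟨_, Set.mem_univ _, toDat_eq_ofTuple_bits (h.candidate _ hz).1, fun _ hj => h.update hz hj⟩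

end PatternState

theorem hiddenPolyTime_binaryBoolean (R : ℕ → Set (Set (Fin 2 → Fin 2))) :
    (binaryBoolean R).HiddenPolyTime :=
  (PatternState.learner R).hiddenPolyTime .id

/-! ### Monotone properties -/

section Greedy

variable {α : Type*} [DecidableEq α] {p : List α → Bool} {l : List α}

/-- The removal of `e` from `s`, if this preserves the property `p`. -/
def tryRemove (p : List α → Bool) (s : List α) (e : α) : List α :=
  if p (s.filter (· ≠ e)) then s.filter (· ≠ e) else s

/-- A sublist of `l` that is minimal with the property `p`, if `p` is increasing and holds for
`l`. -/
def greedy (p : List α → Bool) (l : List α) : List α := l.foldl (tryRemove p) l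

theorem tryRemove_sublist (p : List α → Bool) (s : List α) (e : α) :
    (tryRemove p s e).Sublist s := by
  unfold tryRemove
  split
  exacts [List.filter_sublist, .refl s]

theorem foldl_tryRemove_sublist (p : List α → Bool) (l : List α) :
    ∀ s, (l.foldl (tryRemove p) s).Sublist s := by
  induction l with
  | nil => exact .refl
  | cons e l ih => exact fun s => (ih _).trans (tryRemove_sublist p s e)

theorem greedy_sublist (p : List α → Bool) (l : List α) : (greedy p l).Sublist l :=
  foldl_tryRemove_sublist p l l

theorem greedy_of_prop (hl : p l) : p (greedy p l) := by
  refine List.foldlRecOn l (tryRemove p) (motive := fun s => p s) hl fun s hs e _ => ?_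
  unfold tryRemove
  split
  · assumption
  · exact hs

theorem not_prop_filter_greedy (hp : ∀ {s s' : List α}, s ⊆ s' → p s → p s') {e : α}
    (he : e ∈ greedy p l) : ¬ p ((greedy p l).filter (· ≠ e)) := by
  have minimal (l : List α) : ∀ s, ∀ e ∈ l, e ∈ l.foldl (tryRemove p) s →
      ¬ p ((l.foldl (tryRemove p) s).filter (· ≠ e)) := by
    induction l with
    | nil => simp
    | cons x l ih =>
      intro s e he hmem hpe
      rw [List.foldl_cons] at hmem hpe
      obtain rfl | he := List.mem_cons.1 he
      · have hsub := foldl_tryRemove_sublist p l (tryRemove p s e)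
        have hmem' := hsub.subset hmem
        have hpe' := hp ((hsub.trans (tryRemove_sublist p s e)).filter _).subset hpe
        rw [tryRemove, if_pos hpe'] at hmem'
        simp at hmem'
      · exact ih _ e he hmem hpe
  exact minimal l l e ((greedy_sublist p l).subset he) he

end Greedy

theorem polyTime_greedy {α : Type} [ToDat α] {p : α → List ℕ → Bool} {l : α → List ℕ}
    (hp : PolyTime fun x : α × List ℕ => p x.1 x.2) (hl : PolyTime l) :
    PolyTime fun a => greedy (p a) (l a) := by
  refine PolyTime.foldl_of_growth (f := fun a => tryRemove (p a)) ?_ hl hl (.const 0)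
    fun a s e _ => height_le_of_sublist (tryRemove_sublist _ _ _)
  have hremoved : PolyTime fun y : α × List ℕ × ℕ => y.2.1.filter (· ≠ y.2.2) := by fun_prop
  have hfst : PolyTime fun y : α × List ℕ × ℕ => y.1 := by fun_prop
  exact .ite (hp.comp (hfst.prodMk hremoved)).decide_eq_true hremoved (by fun_prop)

/-- The assignment with the values different from `v` in the positions `l`, as a list. -/
def indicator (v : Fin 2) (k : ℕ) (l : List ℕ) : List Bool :=
  (List.range k).map fun i => decide (i ∈ l) ^^ decide (v = 1)

theorem toDat_indicator (v : Fin 2) (k : ℕ) (l : List ℕ) :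
    toDat (indicator v k l) = Dat.ofTuple (bits k (indicator v k l)) :=
  toDat_eq_ofTuple_bits (by simp [indicator])

theorem bits_indicator_ne_iff {v : Fin 2} {k : ℕ} {l : List ℕ} {i : Fin k} :
    bits k (indicator v k l) i ≠ v ↔ (i : ℕ) ∈ l := by
  rw [bits, indicator, getD_map_range _ i.2]
  by_cases h : (i : ℕ) ∈ l <;> revert v <;> simp [h]

@[fun_prop]
theorem polyTime_indicator {α : Type} [ToDat α] {v : Fin 2} {k : α → ℕ} {l : α → List ℕ}
    (hk : PolyTime k) (hl : PolyTime l) : PolyTime fun a => indicator v (k a) (l a) := by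
  unfold indicator
  fun_prop

/-- The problem to find an assignment in `W` that has the value `v` in the positions named by the
constraints. -/
def unaryCSP (len : ℕ → ℕ) (W : ∀ n, Set (Fin (len n) → Fin 2)) (v : Fin 2) : CSP where
  w _ := 2
  len := len
  q _ := 1
  W := W
  rels _ := {{b | b 0 = v}}

/-- In the search for an assignment, the positions in which a value different from the one required
by the constraints has not yet been excluded. -/
abbrev AllowedState : Type := {n : ℕ // 0 < n} × List ℕ

namespace AllowedState

variable {len : ℕ → ℕ} {f : ∀ n, (Fin (len n) → Fin 2) → Prop}
  {W : ∀ n, Set (Fin (len n) → Fin 2)} {v : Fin 2}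

open scoped Classical in
/-- Whether the set `l` of positions with values different from `v` has the property `f`. -/
noncomputable def test (f : ∀ n, (Fin (len n) → Fin 2) → Prop) (v : Fin 2) (n : {n : ℕ // 0 < n})
    (l : List ℕ) : Bool :=
  decide (f n (bits (len n) (indicator v (len n) l)))

theorem test_iff {n : {n : ℕ // 0 < n}} {l : List ℕ} :
    test f v n l ↔ f n (bits (len n) (indicator v (len n) l)) := by
  simp [test]

/-- The proposal of an assignment that has the property `f` and differs from `v` in a minimal set of
allowed positions. -/
noncomputable def propose (f : ∀ n, (Fin (len n) → Fin 2) → Prop) (v : Fin 2) (s : AllowedState) :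
    Option (List Bool) :=
  if test f v s.1 s.2 then some (indicator v (len s.1) (greedy (test f v s.1) s.2)) else none

theorem polyTime_test (hlen : PolyTime len) (hf : DecidablePolyTime len f) :
    PolyTime fun x : AllowedState => test f v x.1 x.2 := by
  have hpair : PolyTime fun x : AllowedState => (x.1, indicator v (len x.1) x.2) := by fun_prop
  refine hf.polyTime.comp (f := fun x : AllowedState =>
    ⟨x.1, bits (len x.1) (indicator v (len x.1) x.2)⟩) (hpair.of_toDat_apply_eq fun x => ?_)
  exact congrArg (Dat.cons _) (toDat_indicator _ _ _)

theorem polyTime_propose (hlen : PolyTime len) (hf : DecidablePolyTime len f) :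
    PolyTime (propose f v) := by
  have htest : PolyTime fun x : AllowedState => test f v x.1 x.2 := polyTime_test hlen hf
  have hn : PolyTime fun x : AllowedState × List ℕ => x.1.1 := by fun_prop
  have hl : PolyTime fun x : AllowedState × List ℕ => x.2 := by fun_prop
  have hgreedy : PolyTime fun s : AllowedState => greedy (test f v s.1) s.2 :=
    polyTime_greedy (p := fun s : AllowedState => test f v s.1) (htest.comp (hn.prodMk hl))
      (by fun_prop)
  exact .ite htest.decide_eq_true (.some (polyTime_indicator (by fun_prop) hgreedy)) (.const none)

/-- After an answer that names a position, its value in every solution is known. -/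
def update (x : (AllowedState × List Bool) × List ℕ) : AllowedState :=
  (x.1.1.1, x.1.1.2.filter (· ≠ x.2.getD 0 0))

/-- The possible states of a run on `C` in which at most `r` further proposals are rejected. -/
structure Inv {n m : ℕ} (C : (unaryCSP len W v).Instance n m) (r : ℕ) (s : AllowedState) :
    Prop where
  val_eq : s.1 = n
  sublist : s.2.Sublist (List.range (len n))
  mem_of_ne : ∀ a, CSP.Satisfies (S := unaryCSP len W v) a C → ∀ i, a i ≠ v → (i : ℕ) ∈ s.2
  rank : s.2.length < r

theorem Inv.height_le {n m r : ℕ} {C : (unaryCSP len W v).Instance n m} {s : AllowedState}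
    (h : Inv C r s) : height s ≤ n + 2 * len n + 1 := by
  have hl : height s.2 ≤ len n + s.2.length := height_list_le fun i hi => by
    rw [height_nat]
    exact (List.mem_range.1 (h.sublist.subset hi)).le
  have hlength := h.sublist.length_le
  rw [List.length_range] at hlength
  have hn : height s.1 = n := (height_nat _).trans h.val_eq
  change max (height s.1) (height s.2) + 1 ≤ _
  omega

theorem Inv.update {n m r : ℕ} {C : (unaryCSP len W v).Instance n m} {s : AllowedState}
    (h : Inv C r s) {z : List Bool} {a : Fin (len n) → Fin 2} (ha : ∀ i, a i ≠ v → (i : ℕ) ∈ s.2)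
    {j : Fin m} (hj : ¬ CSP.Constraint.Sat (S := unaryCSP len W v) (C j) a) :
    ∃ r' < r, Inv C r' (update ((s, z), List.ofFn fun i => ((C j).vars i : ℕ))) := by
  have hrel : (C j).rel = {b : Fin 1 → Fin 2 | b 0 = v} := (C j).rel_mem
  have sat_iff (b : Fin (len n) → Fin 2) :
      CSP.Constraint.Sat (S := unaryCSP len W v) (C j) b ↔ b ((C j).vars (0 : Fin 1)) = v := by
    change (fun i => b ((C j).vars i)) ∈ (C j).rel ↔ _
    rw [hrel]
    rfl
  set e := (C j).vars (0 : Fin 1)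
  have he : (e : ℕ) ∈ s.2 := ha e (mt (sat_iff a).2 hj)
  have update_eq : AllowedState.update ((s, z), List.ofFn fun i => ((C j).vars i : ℕ)) =
    (s.1, s.2.filter (· ≠ (e : ℕ))) := rfl
  rw [update_eq]
  have hlt : (s.2.filter (· ≠ (e : ℕ))).length < s.2.length :=
    List.length_filter_lt_length_iff_exists.2 ⟨e, he, by simp⟩
  refine ⟨s.2.length, h.rank, h.val_eq, List.filter_sublist.trans h.sublist, fun b hb i hi => ?_,
    hlt⟩
  have hie : i ≠ e := by
    rintro rfl
    exact hi ((sat_iff b).1 (hb j))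
  simpa [Fin.val_ne_of_ne hie] using h.mem_of_ne b hb i hi

section Minimal

variable (mono : ∀ n a b, (∀ i, a i ≠ v → b i ≠ v) → f n a → f n b)
  (hW : ∀ n a, a ∈ W n ↔ f n a ∧ ∀ b, (∀ i, b i ≠ v → a i ≠ v) → f n b → ∀ i, a i ≠ v → b i ≠ v)

include mono

theorem test_of_forall_mem {n : {n : ℕ // 0 < n}} {l : List ℕ} {a : Fin (len n) → Fin 2}
    (ha : f n a) (h : ∀ i, a i ≠ v → (i : ℕ) ∈ l) : test f v n l :=
  test_iff.2 (mono _ _ _ (fun i hi => bits_indicator_ne_iff.2 (h i hi)) ha)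

include hW

theorem bits_greedy_mem {n : {n : ℕ // 0 < n}} {l : List ℕ} (h : test f v n l) :
    bits (len n) (indicator v (len n) (greedy (test f v n) l)) ∈ W n := by
  rw [hW]
  refine ⟨test_iff.1 (greedy_of_prop (p := test f v n) h), fun b hb hfb i hi hbi => ?_⟩
  have test_mono {l l' : List ℕ} (hll' : l ⊆ l') (hl : test f v n l) : test f v n l' :=
    test_of_forall_mem mono (test_iff.1 hl) fun i hi => hll' (bits_indicator_ne_iff.1 hi)
  refine not_prop_filter_greedy test_mono (bits_indicator_ne_iff.1 hi)
    (test_of_forall_mem mono hfb fun k hk => ?_)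
  have hki : k ≠ i := by
    rintro rfl
    exact hk hbi
  simpa [Fin.val_ne_of_ne hki] using bits_indicator_ne_iff.1 (hb k hk)

/-- The learner that proposes a minimal assignment on the allowed positions. -/
noncomputable def learner (hlen : PolyTime len) (hf : DecidablePolyTime len f) :
    Learner (unaryCSP len W v) AllowedState (List Bool) where
  init n := (n, List.range (len n))
  propose := propose f v
  update := update
  polyTime_init := by fun_prop
  polyTime_propose := polyTime_propose hlen hf
  polyTime_update := by unfold update; fun_prop
  Inv := Inv
  bound n := n + 2 * len n + 1
  polyBounded_bound := (PolyBounded.id.add (.mul (.const 2) hlen.polyBounded)).add (.const 1)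
  inv_init n m C :=
    { val_eq := rfl
      sublist := .refl _
      mem_of_ne := fun _ _ i _ => List.mem_range.2 i.2
      rank := by simp only [List.length_range]; omega }
  height_le := Inv.height_le
  not_satisfies := by
    rintro n m C r ⟨⟨n, hn⟩, l⟩ ⟨rfl, -, mem_of_ne, -⟩ hnone a ha hsat
    have := test_of_forall_mem (n := ⟨n, hn⟩) mono ((hW n a).1 ha).1 (mem_of_ne a hsat)
    simp [propose, this] at hnone
  inv_update := by
    rintro n m C r ⟨⟨n, hn⟩, l⟩ z h hz
    obtain rfl := h.val_eq
    unfold propose at hz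
    split_ifs at hz with htest
    obtain rfl := Option.some.inj hz
    exact ⟨_, bits_greedy_mem mono hW htest, toDat_indicator _ _ _, fun j hj => h.update
      (fun i hi => (greedy_sublist _ l).subset (bits_indicator_ne_iff.1 hi)) hj⟩

end Minimal

end AllowedState

theorem forall_ne_zero_imp_iff {k : ℕ} {a b : Fin k → Fin 2} :
    (∀ i, a i ≠ 0 → b i ≠ 0) ↔ a ≤ b := by
  have ne_zero_imp_iff : ∀ x y : Fin 2, (x ≠ 0 → y ≠ 0) ↔ x ≤ y := by decide
  exact forall_congr' fun _ => ne_zero_imp_iff _ _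

theorem forall_ne_one_imp_iff {k : ℕ} {a b : Fin k → Fin 2} :
    (∀ i, a i ≠ 1 → b i ≠ 1) ↔ b ≤ a := by
  have ne_one_imp_iff : ∀ x y : Fin 2, (x ≠ 1 → y ≠ 1) ↔ y ≤ x := by decide
  exact forall_congr' fun _ => ne_one_imp_iff _ _

theorem minimal_iff_forall_ne_zero {k : ℕ} {f : (Fin k → Fin 2) → Prop} {a : Fin k → Fin 2} :
    Minimal f a ↔
      f a ∧ ∀ b, (∀ i, b i ≠ 0 → a i ≠ 0) → f b → ∀ i, a i ≠ 0 → b i ≠ 0 := by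
  simp only [forall_ne_zero_imp_iff]
  exact and_congr_right fun _ => forall_congr' fun _ => forall_comm

theorem maximal_iff_forall_ne_one {k : ℕ} {f : (Fin k → Fin 2) → Prop} {a : Fin k → Fin 2} :
    Maximal f a ↔
      f a ∧ ∀ b, (∀ i, b i ≠ 1 → a i ≠ 1) → f b → ∀ i, a i ≠ 1 → b i ≠ 1 := by
  simp only [forall_ne_one_imp_iff]
  exact and_congr_right fun _ => forall_congr' fun _ => forall_comm

theorem hiddenPolyTime_increasingCSP {len : ℕ → ℕ} (hlen : PolyTime len)
    {f : ∀ n, (Fin (len n) → Fin 2) → Prop} (hf : DecidablePolyTime len f)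
    (mono : ∀ n, Monotone (f n)) : (increasingCSP len f).HiddenPolyTime :=
  (AllowedState.learner (W := fun n => {a | Minimal (f n) a})
    (fun n _ _ hab => mono n (forall_ne_zero_imp_iff.1 hab)) (fun _ _ => minimal_iff_forall_ne_zero)
    hlen hf).hiddenPolyTime hlen.polyBounded

theorem hiddenPolyTime_decreasingCSP {len : ℕ → ℕ} (hlen : PolyTime len)
    {f : ∀ n, (Fin (len n) → Fin 2) → Prop} (hf : DecidablePolyTime len f)
    (anti : ∀ n, Antitone (f n)) : (decreasingCSP len f).HiddenPolyTime :=
  (AllowedState.learner (W := fun n => {a | Maximal (f n) a})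
    (fun n _ _ hab => anti n (forall_ne_one_imp_iff.1 hab)) (fun _ _ => maximal_iff_forall_ne_one)
    hlen hf).hiddenPolyTime hlen.polyBounded

theorem graphOf_mono {n : ℕ} : Monotone (graphOf (n := n)) :=
  fun _ _ hab _ _ ⟨huv, e, he, hae⟩ => ⟨huv, e, he, Fin.last_le_iff.1 (hae.ge.trans (hab e))⟩

theorem digraphOf_mono {n : ℕ} : Monotone (digraphOf (n := n)) :=
  fun _ _ hab _ _ huv => Fin.last_le_iff.1 ((Eq.ge huv).trans (hab _))

/-! ### Spanning trees -/

/-- The position of the pair `{u, v}` in the encoding of graphs by `graphOf`. -/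
def pairIndex (u v : ℕ) : ℕ := (max u v).choose 2 + min u v

theorem pairIndex_of_lt {u v : ℕ} (h : u < v) : pairIndex u v = v.choose 2 + u := by
  rw [pairIndex, max_eq_right h.le, min_eq_left h.le]

theorem choose_two_succ (v : ℕ) : (v + 1).choose 2 = v.choose 2 + v := by
  rw [Nat.choose_succ_succ' v 1, Nat.choose_one_right, add_comm]

theorem choose_two_add_lt {u v n : ℕ} (huv : u < v) (hv : v < n) :
    v.choose 2 + u < n.choose 2 := by
  have := Nat.choose_le_choose 2 (Nat.succ_le_of_lt hv)
  rw [Nat.succ_eq_add_one, choose_two_succ] at this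
  omega

theorem pairIndex_lt {u v n : ℕ} (huv : u ≠ v) (hu : u < n) (hv : v < n) :
    pairIndex u v < n.choose 2 :=
  choose_two_add_lt (min_lt_max.2 huv) (max_lt hu hv)

theorem pairIndex_eq_pairIndex {u v u' v' : ℕ} (huv : u ≠ v) (huv' : u' ≠ v')
    (h : pairIndex u v = pairIndex u' v') : max u v = max u' v' ∧ min u v = min u' v' := by
  have hlt := min_lt_max.2 huv
  have hlt' := min_lt_max.2 huv'
  unfold pairIndex at h
  rcases lt_trichotomy (max u v) (max u' v') with hmax | hmax | hmax
  · have := choose_two_add_lt hlt hmax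
    omega
  · rw [hmax] at h
    exact ⟨hmax, by omega⟩
  · have := choose_two_add_lt hlt' hmax
    omega

theorem exists_pairIndex_eq {n e : ℕ} (he : e < n.choose 2) :
    ∃ u v, u < v ∧ v < n ∧ pairIndex u v = e := by
  induction n with
  | zero => simp at he
  | succ n ih =>
    rcases lt_or_ge e (n.choose 2) with h | h
    · obtain ⟨u, v, huv, hv, rfl⟩ := ih h
      exact ⟨u, v, huv, by omega, rfl⟩
    · rw [choose_two_succ] at he
      exact ⟨e - n.choose 2, n, by omega, by omega, by rw [pairIndex_of_lt (by omega)]; omega⟩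

theorem graphOf_adj {n : ℕ} {a : Fin (n.choose 2) → Fin 2} {u v : Fin n} :
    (graphOf a).Adj u v ↔
      u ≠ v ∧ ∃ e : Fin (n.choose 2), (e : ℕ) = pairIndex u v ∧ a e = 1 :=
  .rfl

theorem graphOf_le_graphOf_iff {n : ℕ} {a b : Fin (n.choose 2) → Fin 2} :
    graphOf a ≤ graphOf b ↔ a ≤ b := by
  refine ⟨fun h => forall_ne_zero_imp_iff.1 fun e he => ?_, fun h => graphOf_mono h⟩
  obtain ⟨u, v, huv, hv, hidx⟩ := exists_pairIndex_eq e.2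
  obtain ⟨-, e', he', hb⟩ := graphOf_adj.1 <| h (v := ⟨u, huv.trans hv⟩) (w := ⟨v, hv⟩)
    (graphOf_adj.2 ⟨by simpa using huv.ne, e, hidx.symm, Fin.eq_one_of_ne_zero _ he⟩)
  obtain rfl : e = e' := Fin.ext (hidx.symm.trans he'.symm)
  simp [hb]

theorem graphOf_surjective {n : ℕ} : Function.Surjective (graphOf (n := n)) := by
  classical
  intro G
  refine ⟨fun e => if ∃ u v, G.Adj u v ∧ pairIndex u v = e then 1 else 0, ?_⟩
  ext u v
  simp only [graphOf_adj, ite_eq_left_iff, zero_ne_one, imp_false, not_not]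
  constructor
  · rintro ⟨huv, e, he, u', v', hadj, hidx⟩
    obtain ⟨hmax, hmin⟩ := pairIndex_eq_pairIndex (Fin.val_ne_of_ne huv)
      (Fin.val_ne_of_ne hadj.ne) (he.symm.trans hidx.symm)
    have : u = u' ∧ v = v' ∨ u = v' ∧ v = u' := by omega
    obtain ⟨rfl, rfl⟩ | ⟨rfl, rfl⟩ := this
    exacts [hadj, hadj.symm]
  · intro h
    exact ⟨h.ne, ⟨pairIndex u v, pairIndex_lt (Fin.val_ne_of_ne h.ne) u.2 v.2⟩, rfl, u, v, h, rfl⟩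

/-- The assignment `a` describes a connected graph that contains the edges in `c`. -/
def Spans {n : ℕ} (c a : Fin (n.choose 2) → Fin 2) : Prop := (graphOf a).Connected ∧ c ≤ a

theorem Spans.mono {n : ℕ} {c a b : Fin (n.choose 2) → Fin 2} (h : Spans c a) (hab : a ≤ b) :
    Spans c b :=
  ⟨h.1.mono (graphOf_mono hab), h.2.trans hab⟩

theorem minimal_spans_of_isTree {n : ℕ} {c a : Fin (n.choose 2) → Fin 2} (ha : (graphOf a).IsTree)
    (hca : c ≤ a) : Minimal (Spans c) a :=
  ⟨⟨ha.connected, hca⟩, fun _ hb hba => graphOf_le_graphOf_iff.1 <|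
    (SimpleGraph.isTree_iff_minimal_connected.1 ha).le_of_le hb.1 (graphOf_mono hba)⟩

theorem isTree_of_minimal_spans {n : ℕ} {c a : Fin (n.choose 2) → Fin 2}
    (ha : Minimal (Spans c) a) (hc : (graphOf c).IsAcyclic) : (graphOf a).IsTree := by
  obtain ⟨T, hcT, hTa, hT⟩ :=
    ha.prop.1.exists_isTree_le_of_le_of_isAcyclic (graphOf_mono ha.prop.2) hc
  obtain ⟨b, rfl⟩ := graphOf_surjective T
  rw [graphOf_le_graphOf_iff] at hcT hTa
  rwa [← ha.eq_of_le ⟨hT.connected, hcT⟩ hTa]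

/-- The graph on `n` vertices with the edges in the positions `l`. -/
abbrev listGraph (n : ℕ) (l : List ℕ) : SimpleGraph (Fin n) :=
  graphOf (bits (n.choose 2) (indicator 0 (n.choose 2) l))

theorem listGraph_adj {n : ℕ} {l : List ℕ} {u v : Fin n} :
    (listGraph n l).Adj u v ↔ u ≠ v ∧ pairIndex u v ∈ l := by
  have bit_eq_one_iff (e : Fin (n.choose 2)) :
      bits (n.choose 2) (indicator 0 (n.choose 2) l) e = 1 ↔ (e : ℕ) ∈ l := by
    rw [← bits_indicator_ne_iff (v := 0)]
    omega
  simp only [graphOf_adj, bit_eq_one_iff]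
  refine and_congr_right fun huv => ⟨?_, fun h =>
    ⟨⟨_, pairIndex_lt (Fin.val_ne_of_ne huv) u.2 v.2⟩, rfl, h⟩⟩
  rintro ⟨e, he, hel⟩
  exact he ▸ hel

/-- The pairs of adjacent vertices of the graph on `n` vertices with the edges in the positions
`l`. -/
def arcs (n : ℕ) (l : List ℕ) : List (ℕ × ℕ) :=
  (List.range n ×ˢ List.range n).filter fun r => r.1 ≠ r.2 ∧ pairIndex r.1 r.2 ∈ l

theorem mem_arcs_iff {n : ℕ} {l : List ℕ} {u v : ℕ} :
    (u, v) ∈ arcs n l ↔ ∃ (hu : u < n) (hv : v < n),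
      (listGraph n l).Adj ⟨u, hu⟩ ⟨v, hv⟩ := by
  simp only [arcs, List.mem_filter, List.mem_product, List.mem_range, decide_eq_true_eq]
  simp only [listGraph_adj]
  grind

theorem mem_reach_arcs_iff {n : ℕ} {l : List ℕ} {u v : Fin n} :
    (v : ℕ) ∈ reach (arcs n l) u ↔
      (listGraph n l).Reachable u v := by
  rw [mem_reach, SimpleGraph.reachable_iff_reflTransGen]
  refine ⟨fun h => ?_, fun h => h.lift _ fun _ _ hadj => mem_arcs_iff.2 ⟨_, _, hadj⟩⟩
  have lift {k : ℕ} (h : Relation.ReflTransGen (fun p q => (p, q) ∈ arcs n l) u k) :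
      ∃ hk : k < n, Relation.ReflTransGen
        (listGraph n l).Adj u ⟨k, hk⟩ := by
    induction h with
    | refl => exact ⟨u.2, .refl⟩
    | tail _ hpq ih =>
      obtain ⟨_, hq, hadj⟩ := mem_arcs_iff.1 hpq
      exact ⟨hq, ih.2.tail hadj⟩
  exact (lift h).2

theorem connected_listGraph_iff {n : ℕ} (hn : 0 < n) {l : List ℕ} :
    (listGraph n l).Connected ↔ ∀ k < n, k ∈ reach (arcs n l) 0 := by
  have : Nonempty (Fin n) := ⟨⟨0, hn⟩⟩
  have reach_iff (k : Fin n) : (k : ℕ) ∈ reach (arcs n l) 0 ↔ (listGraph n l).Reachable ⟨0, hn⟩ k :=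
    mem_reach_arcs_iff (u := ⟨0, hn⟩)
  constructor
  · exact fun h k hk => (reach_iff ⟨k, hk⟩).2 (h.preconnected _ _)
  · exact fun h => (SimpleGraph.connected_iff_exists_forall_reachable _).2
      ⟨⟨0, hn⟩, fun k => (reach_iff k).1 (h k k.2)⟩

/-- In the search for a spanning tree, the positions in which the values `1` and `0`, respectively,
have not yet been excluded. -/
abbrev TreeState : Type := {n : ℕ // 0 < n} × List ℕ × List ℕ

namespace TreeState

/-- Whether the edges in the positions `l` form a connected graph that contains those in `c`. -/
noncomputable def spanTest (c : List Bool) (n : {n : ℕ // 0 < n}) (l : List ℕ) : Bool :=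
  AllowedState.test (fun n a => Spans (bits (n.choose 2) c) a) 0 n l

theorem spanTest_iff {c : List Bool} {n : {n : ℕ // 0 < n}} {l : List ℕ} :
    spanTest c n l ↔ Spans (n := n) (bits _ c) (bits _ (indicator 0 ((n : ℕ).choose 2) l)) :=
  AllowedState.test_iff (f := fun n a => Spans (bits (n.choose 2) c) a)

theorem spanTest_eq (c : List Bool) (n : {n : ℕ // 0 < n}) (l : List ℕ) :
    spanTest c n l = decide ((List.range n).all (fun k => decide (k ∈ reach (arcs n l) 0)) = true ∧
      (List.range ((n : ℕ).choose 2)).all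
        (fun i => decide (¬ (c.getD i false = true ∧ i ∉ l))) = true) := by
  have le_iff : bits ((n : ℕ).choose 2) c ≤ bits _ (indicator 0 ((n : ℕ).choose 2) l) ↔
      ∀ i < (n : ℕ).choose 2, ¬ (c.getD i false = true ∧ i ∉ l) := by
    simp only [← forall_ne_zero_imp_iff, bits_indicator_ne_iff]
    simp [Fin.forall_iff, bits]
  rw [Bool.eq_iff_iff, spanTest_iff, Spans, connected_listGraph_iff n.2, le_iff]
  simp only [decide_eq_true_eq, List.all_eq_true, List.mem_range]

theorem polyTime_spanTest {α : Type} [ToDat α] {c : α → List Bool} {n : α → {n : ℕ // 0 < n}}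
    {l : α → List ℕ} (hc : PolyTime c) (hn : PolyTime n) (hl : PolyTime l) :
    PolyTime fun x => spanTest (c x) (n x) (l x) := by
  simp only [spanTest_eq, arcs, pairIndex]
  fun_prop

theorem spanTest_of_forall_mem {c : List Bool} {n : {n : ℕ // 0 < n}} {l : List ℕ}
    {a : Fin ((n : ℕ).choose 2) → Fin 2} (ha : Spans (bits _ c) a)
    (h : ∀ i, a i ≠ 0 → (i : ℕ) ∈ l) : spanTest c n l :=
  spanTest_iff.2 (ha.mono (forall_ne_zero_imp_iff.1 fun i hi => bits_indicator_ne_iff.2 (h i hi)))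

theorem minimal_spans_greedy {c : List Bool} {n : {n : ℕ // 0 < n}} {l : List ℕ}
    (h : spanTest c n l) :
    Minimal (Spans (n := n) (bits _ c))
      (bits _ (indicator 0 ((n : ℕ).choose 2) (greedy (spanTest c n) l))) :=
  AllowedState.bits_greedy_mem (len := fun n => n.choose 2)
    (W := fun n => {a | Minimal (Spans (bits (n.choose 2) c)) a})
    (fun _ _ _ hab ha => ha.mono (forall_ne_zero_imp_iff.1 hab))
    (fun _ _ => minimal_iff_forall_ne_zero) h

/-- A minimal connected subgraph of the graph with the edges in the positions `s.2.1`, if there is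
one. The edges that are known to be required are removed only as a last resort. -/
noncomputable def tree (s : TreeState) : List ℕ :=
  greedy (spanTest [] s.1) <|
    greedy (spanTest (indicator 1 ((s.1 : ℕ).choose 2) s.2.2) s.1) s.2.1

theorem polyTime_tree : PolyTime tree := by
  have htest {f : TreeState → List Bool} (hf : PolyTime f) :
      PolyTime fun x : TreeState × List ℕ => spanTest (f x.1) x.1.1 x.2 :=
    polyTime_spanTest (by fun_prop) (by fun_prop) (by fun_prop)
  exact polyTime_greedy (p := fun s : TreeState => spanTest [] s.1) (htest (.const []))
    (polyTime_greedy (p := fun s : TreeState => spanTest (indicator 1 _ s.2.2) s.1)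
      (htest (f := fun s => indicator 1 ((s.1 : ℕ).choose 2) s.2.2) (by fun_prop)) (by fun_prop))

theorem tree_sublist (s : TreeState) : (tree s).Sublist s.2.1 :=
  (greedy_sublist _ _).trans (greedy_sublist _ _)

theorem bits_nil_le {k : ℕ} (a : Fin k → Fin 2) : bits k [] ≤ a := fun i => by simp [bits]

theorem isTree_listGraph_tree {s : TreeState} (h : spanTest [] s.1 (tree s)) :
    (listGraph s.1 (tree s)).IsTree := by
  have graphOf_nil {n : ℕ} : graphOf (bits (n.choose 2) []) = ⊥ := by
    ext
    simp [graphOf_adj, bits]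
  refine isTree_of_minimal_spans (minimal_spans_greedy (c := []) ?_)
    (graphOf_nil ▸ SimpleGraph.isAcyclic_bot)
  exact spanTest_of_forall_mem (spanTest_iff.1 h) fun i hi =>
    (greedy_sublist _ _).subset (bits_indicator_ne_iff.1 hi)

theorem spanTest_tree {s : TreeState} {a : Fin ((s.1 : ℕ).choose 2) → Fin 2}
    (ha : (graphOf a).IsTree) (hmem : (∀ i, a i ≠ 0 → (i : ℕ) ∈ s.2.1) ∧
      ∀ i, a i ≠ 1 → (i : ℕ) ∈ s.2.2) :
    spanTest (indicator 1 ((s.1 : ℕ).choose 2) s.2.2) s.1 (tree s) := by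
  set c := indicator 1 ((s.1 : ℕ).choose 2) s.2.2
  have hca : bits _ c ≤ a :=
    forall_ne_one_imp_iff.1 fun i hi => bits_indicator_ne_iff.2 (hmem.2 i hi)
  have hmin := minimal_spans_greedy (spanTest_of_forall_mem ⟨ha.connected, hca⟩ hmem.1)
  have htree := isTree_of_minimal_spans hmin (ha.isAcyclic.anti (graphOf_mono hca))
  have hmin_nil := minimal_spans_of_isTree htree (bits_nil_le _)
  have hmin_tree := minimal_spans_greedy (spanTest_iff.2 hmin_nil.prop)
  have hle := hmin_nil.le_of_le hmin_tree.prop <| forall_ne_zero_imp_iff.1 fun i hi =>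
    bits_indicator_ne_iff.2 ((greedy_sublist _ _).subset (bits_indicator_ne_iff.1 hi))
  exact spanTest_iff.2 (hmin.prop.mono hle)

/-- The proposal of a spanning tree that is consistent with the state. -/
noncomputable def propose (s : TreeState) : Option (List Bool) :=
  if spanTest (indicator 1 ((s.1 : ℕ).choose 2) s.2.2) s.1 (tree s) then
    some (indicator 0 ((s.1 : ℕ).choose 2) (tree s))
  else none

theorem polyTime_propose : PolyTime propose := by
  have htree := polyTime_tree
  exact .ite (polyTime_spanTest (c := fun s : TreeState => indicator 1 _ s.2.2)
    (by fun_prop) (by fun_prop) htree).decide_eq_true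
    (.some (polyTime_indicator (by fun_prop) htree)) (.const none)

/-- After an answer that names a position, the value `z` has there is excluded. -/
def update (x : (TreeState × List Bool) × List ℕ) : TreeState :=
  if x.1.2.getD (x.2.getD 0 0) false = true then
    (x.1.1.1, x.1.1.2.1.filter (· ≠ x.2.getD 0 0), x.1.1.2.2)
  else (x.1.1.1, x.1.1.2.1, x.1.1.2.2.filter (· ≠ x.2.getD 0 0))

/-- The possible states of a run on `C` in which at most `r` further proposals are rejected. -/
structure Inv {n m : ℕ} (C : equalitySpanningTree.Instance n m) (r : ℕ) (s : TreeState) :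
    Prop where
  val_eq : s.1 = n
  sublist_left : s.2.1.Sublist (List.range (n.choose 2))
  sublist_right : s.2.2.Sublist (List.range (n.choose 2))
  mem_of_ne : ∀ a : Fin (n.choose 2) → Fin 2, CSP.Satisfies (S := equalitySpanningTree) a C →
    (∀ i, a i ≠ 0 → (i : ℕ) ∈ s.2.1) ∧ ∀ i, a i ≠ 1 → (i : ℕ) ∈ s.2.2
  rank : s.2.1.length + s.2.2.length < r

theorem Inv.height_le {n m r : ℕ} {C : equalitySpanningTree.Instance n m} {s : TreeState}
    (h : Inv C r s) : height s ≤ n + 2 * n.choose 2 + 2 := by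
  have height_sublist {l : List ℕ} (hl : l.Sublist (List.range (n.choose 2))) :
      height l ≤ 2 * n.choose 2 := by
    have hlength := hl.length_le
    rw [List.length_range] at hlength
    have := height_list_le (l := l) (B := n.choose 2) fun i hi => by
      rw [height_nat]
      exact (List.mem_range.1 (hl.subset hi)).le
    omega
  have hn : height s.1 = n := (height_nat _).trans h.val_eq
  have hleft := height_sublist h.sublist_left
  have hright := height_sublist h.sublist_right
  change max (height s.1) (max (height s.2.1) (height s.2.2) + 1) + 1 ≤ _
  omega

theorem exists_sat_iff {n : ℕ} (c : equalitySpanningTree.Constraint n) :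
    ∃ v, ∀ a : Fin (n.choose 2) → Fin 2,
      c.Sat (S := equalitySpanningTree) a ↔ a (c.vars (0 : Fin 1)) = v := by
  have sat_iff (a : Fin (n.choose 2) → Fin 2) :
      c.Sat (S := equalitySpanningTree) a ↔ (fun i => a (c.vars i)) ∈ c.rel := .rfl
  have hrel : c.rel = idRel ∨ c.rel = negRel := c.rel_mem
  obtain h | h := hrel
  · exact ⟨1, fun a => by rw [sat_iff, h]; rfl⟩
  · exact ⟨0, fun a => by rw [sat_iff, h]; rfl⟩

theorem Inv.update {n m r : ℕ} {C : equalitySpanningTree.Instance n m} {s : TreeState}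
    (h : Inv C r s) {z : List Bool} (hz : (∀ i, bits (n.choose 2) z i ≠ 0 → (i : ℕ) ∈ s.2.1) ∧
      ∀ i, bits (n.choose 2) z i ≠ 1 → (i : ℕ) ∈ s.2.2) {j : Fin m}
    (hj : ¬ CSP.Constraint.Sat (S := equalitySpanningTree) (C j) (bits (n.choose 2) z)) :
    ∃ r' < r, Inv C r' (update ((s, z), List.ofFn fun i => ((C j).vars i : ℕ))) := by
  obtain ⟨v, sat_iff⟩ := exists_sat_iff (C j)
  set e := (C j).vars (0 : Fin 1)
  have update_eq : TreeState.update ((s, z), List.ofFn fun i => ((C j).vars i : ℕ)) =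
    if z.getD e false = true then (s.1, s.2.1.filter (· ≠ (e : ℕ)), s.2.2)
    else (s.1, s.2.1, s.2.2.filter (· ≠ (e : ℕ))) := rfl
  have hzv : bits (n.choose 2) z e ≠ v := mt (sat_iff _).2 hj
  have mem_filter {l : List ℕ} {a : Fin (n.choose 2) → Fin 2} (ha : a e = v)
      (hl : ∀ i, a i ≠ v → (i : ℕ) ∈ l) (i) (hi : a i ≠ v) : (i : ℕ) ∈ l.filter (· ≠ (e : ℕ)) := by
    have hie : i ≠ e := by
      rintro rfl
      exact hi ha
    simpa [Fin.val_ne_of_ne hie] using hl i hi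
  have length_filter {l : List ℕ} (he : (e : ℕ) ∈ l) :
      (l.filter (· ≠ (e : ℕ))).length < l.length :=
    List.length_filter_lt_length_iff_exists.2 ⟨e, he, by simp⟩
  refine ⟨s.2.1.length + s.2.2.length, h.rank, ?_⟩
  rw [update_eq]
  split_ifs with hze
  · have hbit : bits (n.choose 2) z e = 1 := if_pos hze
    obtain rfl : v = 0 := by omega
    exact ⟨h.val_eq, List.filter_sublist.trans h.sublist_left, h.sublist_right, fun a ha =>
      ⟨mem_filter ((sat_iff a).1 (ha j)) (h.mem_of_ne a ha).1, (h.mem_of_ne a ha).2⟩,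
      Nat.add_lt_add_right (length_filter (hz.1 e (by omega))) _⟩
  · have hbit : bits (n.choose 2) z e = 0 := if_neg hze
    obtain rfl : v = 1 := by omega
    exact ⟨h.val_eq, h.sublist_left, List.filter_sublist.trans h.sublist_right, fun a ha =>
      ⟨(h.mem_of_ne a ha).1, mem_filter ((sat_iff a).1 (ha j)) (h.mem_of_ne a ha).2⟩,
      Nat.add_lt_add_left (length_filter (hz.2 e (by omega))) _⟩

/-- The learner that proposes a spanning tree consistent with the answers. -/
noncomputable def learner : Learner equalitySpanningTree TreeState (List Bool) where
  init n := (n, List.range ((n : ℕ).choose 2), List.range ((n : ℕ).choose 2))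
  propose := propose
  update := update
  polyTime_init := by fun_prop
  polyTime_propose := polyTime_propose
  polyTime_update := by unfold update; fun_prop
  Inv := Inv
  bound n := n + 2 * n.choose 2 + 2
  polyBounded_bound := by
    have hchoose : PolyBounded fun n : ℕ => n.choose 2 := PolyTime.id.choose_two.polyBounded
    exact (PolyBounded.id.add (.mul (.const 2) hchoose)).add (.const 2)
  inv_init n m C :=
    { val_eq := rfl
      sublist_left := .refl _
      sublist_right := .refl _
      mem_of_ne := fun _ _ => ⟨fun i _ => List.mem_range.2 i.2, fun i _ => List.mem_range.2 i.2⟩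
      rank := by simp only [List.length_range]; omega }
  height_le := Inv.height_le
  not_satisfies := by
    rintro n m C r s h hnone a ha hsat
    obtain rfl := h.val_eq
    have := spanTest_tree ha (h.mem_of_ne a hsat)
    simp [propose, this] at hnone
  inv_update := by
    rintro n m C r s z h hz
    obtain rfl := h.val_eq
    unfold propose at hz
    split_ifs at hz with htest
    obtain rfl := Option.some.inj hz
    have hspans := spanTest_iff.1 htest
    refine ⟨_, isTree_listGraph_tree (spanTest_iff.2 ⟨hspans.1, bits_nil_le _⟩),
      toDat_indicator _ _ _, fun j hj => h.update ⟨fun i hi => ?_, fun i hi => ?_⟩ hj⟩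
    · exact (tree_sublist s).subset (bits_indicator_ne_iff.1 hi)
    · exact bits_indicator_ne_iff.1 (forall_ne_one_imp_iff.2 hspans.2 i hi)

end TreeState

theorem hiddenPolyTime_equalitySpanningTree : equalitySpanningTree.HiddenPolyTime :=
  TreeState.learner.hiddenPolyTime PolyTime.id.choose_two.polyBounded

end HiddenCSP

theorem mainTheorem8 :
    -- (a) 2-SAT, and arbitrary sets of binary Boolean relations
    (twoSAT.HiddenPolyTime ∧
      ∀ R : ℕ → Set (Set (Fin 2 → Fin 2)), (binaryBoolean R).HiddenPolyTime) ∧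
    -- (b) exact unique games over an alphabet with two letters
    (uniqueGames 2).HiddenPolyTime ∧
    -- (c) polynomial-time monotone properties of graphs and of directed graphs
    ((∀ P : ∀ n, SimpleGraph (Fin n) → Prop,
        DecidablePolyTime (fun n => n.choose 2) (fun n a => P n (graphOf a)) →
          ((∀ n, Monotone (P n)) →
            (increasingCSP (fun n => n.choose 2) fun n a => P n (graphOf a)).HiddenPolyTime) ∧
          ((∀ n, Antitone (P n)) →
            (decreasingCSP (fun n => n.choose 2) fun n a => P n (graphOf a)).HiddenPolyTime)) ∧
      (∀ P : ∀ n, Digraph (Fin n) → Prop,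
        DecidablePolyTime (fun n => n * n) (fun n a => P n (digraphOf a)) →
          ((∀ n, Monotone (P n)) →
            (increasingCSP (fun n => n * n) fun n a => P n (digraphOf a)).HiddenPolyTime) ∧
          ((∀ n, Antitone (P n)) →
            (decreasingCSP (fun n => n * n) fun n a => P n (digraphOf a)).HiddenPolyTime))) ∧
    -- (d) equality to a spanning tree
    equalitySpanningTree.HiddenPolyTime :=
  ⟨⟨hiddenPolyTime_binaryBoolean _, hiddenPolyTime_binaryBoolean⟩,
    hiddenPolyTime_binaryBoolean _,
    ⟨fun _ hP => ⟨
        fun mono => hiddenPolyTime_increasingCSP (.choose_two .id) hP fun n =>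
          (mono n).comp graphOf_mono,
        fun anti => hiddenPolyTime_decreasingCSP (.choose_two .id) hP fun n =>
          (anti n).comp_monotone graphOf_mono⟩,
      fun _ hP => ⟨
        fun mono => hiddenPolyTime_increasingCSP (.mul .id .id) hP fun n =>
          (mono n).comp digraphOf_mono,
        fun anti => hiddenPolyTime_decreasingCSP (.mul .id .id) hP fun n =>
          (anti n).comp_monotone digraphOf_mono⟩⟩,
    hiddenPolyTime_equalitySpanningTree⟩
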